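/- Let $\varTheta\subset\mathbb R^q$ be open, bounded and convex with closure $\varTheta^c$, let $\theta\in\varTheta$, and let $a:\mathbb R_+\times\varTheta^c\to\mathbb R$ be continuous with $a(t,\cdot)\in C^1(\varTheta)$ for every $t\ge 0$. Let $\varepsilon=\{\varepsilon(t),t\in\mathbb R\}$ be a real stochastic process on a probability space, with $E\varepsilon(t)=0$, continuous in mean square and with almost surely continuous paths, and observe $X(t)=a(t,\theta)+\varepsilon(t)$, $t\ge0$. A least squares estimator $\theta_T$ is a random vector with values in $\varTheta^c$ that almost surely minimizes $Q_T(\tau)=\int_0^T (X(t)-a(t,\tau))^2\,dt$ over $\tau\in\varTheta^c$. Assume that $\varepsilon$ is jointly strictly sub-Gaussian, that is, for all $n\ge1$, $t_1,\dots,t_n\in\mathbb R$ and $\Delta_1,\dots,\Delta_n\in\mathbb R$, $$E\exp\Big\{\sum_{i}\Delta_i\varepsilon(t_i)\Big\}\le\exp\Big\{\tfrac12\sum_{i,j}E[\varepsilon(t_i)\varepsilon(t_j)]\,\Delta_i\Delta_j\Big\},$$ and that $\varepsilon$ is (wide-sense) stationary with a spectral density $f\ge0$, i.e. $E\varepsilon(s)\varepsilon(s+t)=\int_{-\infty}^{\infty}e^{i\lambda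 t}f(\lambda)\,d\lambda$ for all $s,t$, with $0<f_0:=\sup_{\lambda}f(\lambda)<\infty$. Put $d_0=2\pi f_0$. Let $T_0,R_0\ge0$. For $T>T_0$ let $d_T(\theta)=\mathrm{diag}(d_{1T}(\theta),\dots,d_{qT}(\theta))$ with $d_{iT}(\theta)\geq 0$, $d_{iT}^2(\theta)=\int_0^T\big(\tfrac{\partial}{\partial\theta_i}a(t,\theta)\big)^2dt$, and assume $0<d_{iT}(\theta)<\infty$. Let $U_T=d_T(\theta)(\varTheta^c-\theta)$, $\Gamma_{T,R}=U_T\cap\{u:R\le\|u\|\le R+1\}$ and, for $u,v\in U_T$, $$\varPhi_T(u,v)=\int_0^T\big(a(t,\theta+d_T^{-1}(\theta)u)-a(t,\theta+d_T^{-1}(\theta)v)\big)^2dt .$$ Let $g=g_T(R)$, $T,R>0$, be a real function such that, for each fixed $T$, $R\mapsto g_T(R)$ is nondecreasing and tends to $\infty$ as $R\to\infty$, and, for every $r>0$, $R^re^{-g_T(R)}\to0$ as $R,T\to\infty$. Assume that there are constants $\delta\in(0,\tfrac12)$, $\varkappa>0$, $\rho\in(0,1]$ and polynomials $\gamma_1,\gamma_2$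 (with coefficients not depending on $T,u,v$) such that for all $T>T_0$ and $R>R_0$: (R1) (i) $\varPhi_T(u,v)\le\gamma_1(R)\|u-v\|^{2\rho}$ for all $u,v\in\Gamma_{T,R}$ with $\|u-v\|\le\varkappa$; (ii) $\varPhi_T(u,0)\le\gamma_2(R)$ for all $u\in\Gamma_{T,R}$; (R2) $\varPhi_T(u,0)\ge 2d_0\delta^{-2}g_T(R)$ for all $u\in\Gamma_{T,R}$. Then for every $\beta>0$ there are constants $B_0,b_0>0$ with $$b_0\ge\frac{\rho}{\rho+q}-\beta$$ such that for all $T>T_0$, $R>R_0$ and every least squares estimator $\theta_T$, $$P\big\{\|d_T(\theta)(\theta_T-\theta)\|\ge R\big\}\le B_0\exp\{-b_0\,g_T(R)\}.$$ -/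

import Mathlib

open MeasureTheory Set Filter Topology

noncomputable section

namespace RegressionLSE

/-! ### The noise process -/

section Noise

variable {Ω : Type*} [MeasurableSpace Ω]

/-- `ε` is a real second-order process on `ℝ` with mean zero that is continuous in mean square and
has almost surely continuous sample paths. -/
structure IsCenteredContinuousProcess (P : Measure Ω) (ε : ℝ → Ω → ℝ) : Prop where
  measurable : ∀ t, Measurable (ε t)
  memLp_two : ∀ t, MemLp (ε t) 2 P
  mean_zero : ∀ t, ∫ ω, ε t ω ∂P = 0
  meanSquare_continuous :
    ∀ t, Tendsto (fun s => ∫ ω, (ε s ω - ε t ω) ^ 2 ∂P) (𝓝 t) (𝓝 0)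
  ae_continuous : ∀ᵐ ω ∂P, Continuous (fun t => ε t ω)

/-- The covariance function `B(t, s) = E ε(t) ε(s)` of a centred process. -/
def covFun (P : Measure Ω) (ε : ℝ → Ω → ℝ) (t s : ℝ) : ℝ :=
  ∫ ω, ε t ω * ε s ω ∂P

/-- A random vector `ξ = (ξ₁, …, ξₙ)` is strictly sub-Gaussian: for every `Δ ∈ ℝⁿ`,
`E exp ⟨ξ, Δ⟩ ≤ exp (½ ⟨B Δ, Δ⟩)` (in particular the left side is finite), where
`B(i, j) = E ξᵢ ξⱼ`. -/
def IsStrictlySubGaussian (P : Measure Ω) {n : ℕ} (ξ : Fin n → Ω → ℝ) : Prop :=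
  ∀ Δ : Fin n → ℝ,
    Integrable (fun ω => Real.exp (∑ i, ξ i ω * Δ i)) P ∧
    ∫ ω, Real.exp (∑ i, ξ i ω * Δ i) ∂P
      ≤ Real.exp ((1 / 2) * ∑ i, ∑ j, (∫ ω, ξ i ω * ξ j ω ∂P) * Δ i * Δ j)

/-- A process is jointly strictly sub-Gaussian if all its finite-dimensional vectors are strictly
sub-Gaussian. -/
def IsJointlyStrictlySubGaussian (P : Measure Ω) (ε : ℝ → Ω → ℝ) : Prop :=
  ∀ (n : ℕ) (t : Fin n → ℝ), IsStrictlySubGaussian P (fun i => ε (t i))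

/-- Stationarity (in the wide sense) of a centred process: `E ε(t) ε(s)` depends only on `s - t`. -/
def IsStationaryCov (P : Measure Ω) (ε : ℝ → Ω → ℝ) : Prop :=
  ∀ t s : ℝ, covFun P ε t s = covFun P ε 0 (s - t)

/-- `f` is a spectral density of the stationary process `ε`: `f` is nonnegative and integrable, and
`B(t) = E ε(0) ε(t) = ∫ exp (i λ t) f(λ) dλ` for all real `t`. -/
structure IsSpectralDensity (P : Measure Ω) (ε : ℝ → Ω → ℝ) (f : ℝ → ℝ) : Prop where
  nonneg : ∀ l, 0 ≤ f l
  integrable : Integrable f volume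
  cov_eq : ∀ t : ℝ, ((covFun P ε 0 t : ℝ) : ℂ)
    = ∫ l : ℝ, Complex.exp (Complex.I * (l : ℂ) * (t : ℂ)) * (f l : ℂ)

end Noise

/-! ### The regression model and the least squares estimator -/

section Model

variable {q : ℕ}

/-- The function `Q_T(τ) = ∫₀ᵀ (X(t) - a(t, τ))² dt` of an observed path `X`. -/
def leastSquares (a : ℝ → EuclideanSpace ℝ (Fin q) → ℝ) (T : ℝ) (X : ℝ → ℝ)
    (τ : EuclideanSpace ℝ (Fin q)) : ℝ :=
  ∫ t in (0 : ℝ)..T, (X t - a t τ) ^ 2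

/-- `est` is a least squares estimator of the true parameter `θ` from the observations
`X(t) = a(t, θ) + ε(t)`, `0 ≤ t ≤ T`: a random vector with values in the closure of `Θ` that almost
surely minimizes `Q_T` over the closure of `Θ`. -/
structure IsLSE {Ω : Type*} [MeasurableSpace Ω] (P : Measure Ω)
    (a : ℝ → EuclideanSpace ℝ (Fin q) → ℝ) (Θ : Set (EuclideanSpace ℝ (Fin q)))
    (θ : EuclideanSpace ℝ (Fin q)) (ε : ℝ → Ω → ℝ) (T : ℝ)
    (est : Ω → EuclideanSpace ℝ (Fin q)) : Prop where
  measurable : Measurable est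
  mem_closure : ∀ ω, est ω ∈ closure Θ
  isMinOn : ∀ᵐ ω ∂P,
    IsMinOn (leastSquares a T (fun t => a t θ + ε t ω)) (closure Θ) (est ω)

/-- The partial derivative `∂ a(t, θ) / ∂ θᵢ`. -/
def partialDeriv (a : ℝ → EuclideanSpace ℝ (Fin q) → ℝ) (θ : EuclideanSpace ℝ (Fin q))
    (i : Fin q) (t : ℝ) : ℝ :=
  fderiv ℝ (a t) θ (EuclideanSpace.single i 1)

/-- The normalization `d_{iT}(θ)`, with `d_{iT}(θ)² = ∫₀ᵀ (∂ a(t, θ) / ∂ θᵢ)² dt`. -/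
def normCoeff (a : ℝ → EuclideanSpace ℝ (Fin q) → ℝ) (θ : EuclideanSpace ℝ (Fin q))
    (T : ℝ) (i : Fin q) : ℝ :=
  Real.sqrt (∫ t in (0 : ℝ)..T, (partialDeriv a θ i t) ^ 2)

/-- The product `diag (c₁, …, c_q) u`. -/
def diagMul (c : Fin q → ℝ) (u : EuclideanSpace ℝ (Fin q)) : EuclideanSpace ℝ (Fin q) :=
  WithLp.toLp 2 (fun i => c i * u i)

/-- `U_T(θ) = d_T(θ) (Θᶜ - θ)`, where `Θᶜ` is the closure of `Θ`. -/
def localSet (a : ℝ → EuclideanSpace ℝ (Fin q) → ℝ) (Θ : Set (EuclideanSpace ℝ (Fin q)))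
    (θ : EuclideanSpace ℝ (Fin q)) (T : ℝ) : Set (EuclideanSpace ℝ (Fin q)) :=
  (fun τ => diagMul (normCoeff a θ T) (τ - θ)) '' closure Θ

/-- `Γ_{T,θ,R} = U_T(θ) ∩ {u : R ≤ ‖u‖ ≤ R + 1}`. -/
def shell (a : ℝ → EuclideanSpace ℝ (Fin q) → ℝ) (Θ : Set (EuclideanSpace ℝ (Fin q)))
    (θ : EuclideanSpace ℝ (Fin q)) (T R : ℝ) : Set (EuclideanSpace ℝ (Fin q)) :=
  localSet a Θ θ T ∩ {u | R ≤ ‖u‖ ∧ ‖u‖ ≤ R + 1}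

/-- `Δ(t, u) = a(t, θ + d_T(θ)⁻¹ u) - a(t, θ)`. -/
def increment (a : ℝ → EuclideanSpace ℝ (Fin q) → ℝ) (θ : EuclideanSpace ℝ (Fin q))
    (T t : ℝ) (u : EuclideanSpace ℝ (Fin q)) : ℝ :=
  a t (θ + diagMul (fun i => (normCoeff a θ T i)⁻¹) u) - a t θ

/-- `Φ_T(u, v) = ∫₀ᵀ (Δ(t, u) - Δ(t, v))² dt`. -/
def distFun (a : ℝ → EuclideanSpace ℝ (Fin q) → ℝ) (θ : EuclideanSpace ℝ (Fin q))
    (T : ℝ) (u v : EuclideanSpace ℝ (Fin q)) : ℝ :=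
  ∫ t in (0 : ℝ)..T, (increment a θ T t u - increment a θ T t v) ^ 2

end Model

/-- The family `G` of functions `g_T(R)`, `T > 0`, `R > 0` (written `g T R`): for fixed `T` the
function `g_T` is nondecreasing and tends to infinity, and `R ^ r * exp (-g_T(R)) → 0` as
`R, T → ∞` for every `r > 0`. -/
structure IsRateFamily (g : ℝ → ℝ → ℝ) : Prop where
  monotone : ∀ T, 0 < T → MonotoneOn (g T) (Ioi 0)
  tendsto : ∀ T, 0 < T → Tendsto (g T) atTop atTop
  decay : ∀ r : ℝ, 0 < r →
    Tendsto (fun p : ℝ × ℝ => p.2 ^ r * Real.exp (-g p.1 p.2)) (atTop ×ˢ atTop) (𝓝 0)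

end RegressionLSE

end

open RegressionLSE

/-! Write `u` for the normalized error and `b(u) = ∫₀ᵀ ε(t) Δ(t,u) dt`. Comparing the least squares
functional at its minimizer and at `θ` gives `½ Φ(u,0) ≤ b(u)` (`half_distFun_le_of_isMinOn`). So a
deviation of size at least `R` forces this inequality somewhere on one of the shells `R + k`, and it
suffices to bound its probability on each shell and to sum.

The spectral representation and Plancherel bound the variance of `b(u) - b(v)` by `d₀ Φ(u,v)`, and
joint strict sub-Gaussianity then makes this difference sub-Gaussian with that proxy
(`hasSubgaussianMGF_integral`). At a single point, (R2) gives `P{b(v) ≥ δ Φ(v,0)} ≤ exp(-g)`, with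
no loss in the exponent.

To pass to the whole shell, take a net so fine that, outside an event of probability polynomial
times `exp(-g)`, `b` exceeds its value at the net point by at most 1
(`exists_net_measure_oscillation_le`, by chaining). The gap between `δ` and `½` absorbs this 1 and
the change of `Φ`. Since (R1)(ii) and (R2) make `g` at most polynomial in `R`, the mesh can be an
inverse power of `R`, and the net has polynomially many points.

The shell probability is thus polynomial times `exp(-g)` (`exists_shell_bound`). As `g` beats every
logarithm, the polynomial costs an arbitrarily small part of the exponent, so every `b₀ < 1` is
attainable, which is more than `ρ/(ρ+q) - β`. -/

open RegressionLSE

/-! ### Plancherel's identity for functions in `L¹ ∩ L²`. -/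

section Plancherel

open FourierTransform SchwartzMap
open scoped ContDiff

theorem continuous_fourier_of_integrable {φ : ℝ → ℂ} (h1 : Integrable φ) : Continuous (𝓕 φ) :=
  VectorFourier.fourierIntegral_continuous Real.continuous_fourierChar
    (by simpa using! continuous_inner (𝕜 := ℝ) (E := ℝ)) h1

/-- Identifies the abstract `L²` transform with the integral formula. Tested against a smooth
compactly supported function, the former moves the transform onto it by distributional duality, the
latter by Fubini. -/
theorem toLp_fourier_ae_eq {φ : ℝ → ℂ} (h1 : Integrable φ) (h2 : MemLp φ 2) :
    ((𝓕 (h2.toLp φ) : Lp ℂ 2 (volume : Measure ℝ)) : ℝ → ℂ) =ᵐ[volume] 𝓕 φ := by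
  refine ae_eq_of_integral_contDiff_smul_eq
    ((Lp.memLp _).locallyIntegrable (by norm_num))
    (continuous_fourier_of_integrable h1).locallyIntegrable fun g hg hgc => ?_
  have hg' : ContDiff ℝ ∞ (fun x => (g x : ℂ)) := Complex.ofRealCLM.contDiff.comp hg
  have hgc' : HasCompactSupport (fun x => (g x : ℂ)) :=
    hgc.comp_left (g := fun x : ℝ => (x : ℂ)) (by simp)
  let G : 𝓢(ℝ, ℂ) := hgc'.toSchwartzMap hg'
  have hG : ∀ x, G x = (g x : ℂ) := fun x => rfl
  have e1 := congrArg (fun U : 𝓢'(ℝ, ℂ) => U G) (Lp.fourier_toTemperedDistribution_eq (h2.toLp φ))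
  simp only [TemperedDistribution.fourier_apply, Lp.toTemperedDistribution_apply] at e1
  have e2 : ∫ x, (𝓕 G) x • (h2.toLp φ : ℝ → ℂ) x = ∫ x, (𝓕 G) x • φ x :=
    integral_congr_ae (by filter_upwards [h2.coeFn_toLp] with x hx; rw [hx])
  have e3 : ∫ x, (𝓕 G) x • φ x = ∫ x, G x • (𝓕 φ) x := by
    have := VectorFourier.integral_fourierIntegral_smul_eq_flip (μ := (volume : Measure ℝ))
      (ν := (volume : Measure ℝ)) (L := innerₗ ℝ) (f := G) (g := φ)
      Real.continuous_fourierChar continuous_inner G.integrable h1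
    simpa using! this
  calc ∫ x, g x • (𝓕 (h2.toLp φ) : Lp ℂ 2 (volume : Measure ℝ)) x
      = ∫ x, G x • (𝓕 (h2.toLp φ) : Lp ℂ 2 (volume : Measure ℝ)) x := by
        simp only [hG, Complex.real_smul, smul_eq_mul]
    _ = ∫ x, G x • (𝓕 φ) x := by rw [← e1, e2, e3]
    _ = _ := by simp only [hG, Complex.real_smul, smul_eq_mul]

theorem memLp_two_fourier {φ : ℝ → ℂ} (h1 : Integrable φ) (h2 : MemLp φ 2) :
    MemLp (𝓕 φ) 2 :=
  (memLp_congr_ae (toLp_fourier_ae_eq h1 h2)).1 (Lp.memLp _)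

theorem integral_norm_sq_fourier {φ : ℝ → ℂ} (h1 : Integrable φ) (h2 : MemLp φ 2) :
    ∫ x, ‖𝓕 φ x‖ ^ 2 = ∫ x, ‖φ x‖ ^ 2 := by
  have h3 := Lp.norm_fourier_eq (h2.toLp φ)
  rw [Lp.norm_def, Lp.norm_def, eLpNorm_congr_ae (toLp_fourier_ae_eq h1 h2),
    eLpNorm_congr_ae h2.coeFn_toLp,
    (memLp_two_fourier h1 h2).eLpNorm_eq_integral_rpow_norm (by norm_num) (by norm_num),
    h2.eLpNorm_eq_integral_rpow_norm (by norm_num) (by norm_num),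
    ENNReal.toReal_ofReal (by positivity), ENNReal.toReal_ofReal (by positivity)] at h3
  have h4 := (Real.rpow_left_inj (integral_nonneg fun x => by positivity)
    (integral_nonneg fun x => by positivity) (by norm_num)).1 h3
  simpa using! h4

end Plancherel

/-- Left Riemann sums of a continuous function converge to its integral. -/
theorem tendsto_riemannSum {E : Type*} [NormedAddCommGroup E] [NormedSpace ℝ E] [CompleteSpace E]
    {h : ℝ → E} {T : ℝ} (hT : 0 < T) (hh : ContinuousOn h (Icc 0 T)) :
    Tendsto (fun n : ℕ => ∑ i : Fin (n + 1), (T / (n + 1)) • h (i * (T / (n + 1)))) atTop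
      (𝓝 (∫ t in (0 : ℝ)..T, h t)) := by
  rw [Metric.tendsto_atTop]
  intro e he
  have huc : UniformContinuousOn h (Icc 0 T) := isCompact_Icc.uniformContinuousOn_of_continuous hh
  rw [Metric.uniformContinuousOn_iff] at huc
  obtain ⟨d, hd, hdh⟩ := huc (e / (2 * T)) (by positivity)
  obtain ⟨N, hN⟩ := exists_nat_gt (T / d)
  refine ⟨N, fun n hn => ?_⟩
  have hn1 : (0 : ℝ) < n + 1 := by positivity
  set c := T / (n + 1) with hc
  have hc0 : 0 < c := by positivity
  have hcT : ((n + 1 : ℕ) : ℝ) * c = T := by push_cast; rw [hc]; field_simp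
  have hcd : c < d := by
    rw [hc, div_lt_iff₀ hn1]
    rw [div_lt_iff₀ hd] at hN
    have : (N : ℝ) ≤ n := by exact_mod_cast hn
    nlinarith
  have hmem : ∀ k : ℕ, k ≤ n + 1 → (k : ℝ) * c ∈ Icc 0 T := fun k hk =>
    ⟨by positivity, by
      rw [← hcT]; exact mul_le_mul_of_nonneg_right (by exact_mod_cast hk) hc0.le⟩
  have hsub : ∀ k < n + 1, Icc ((k : ℝ) * c) (((k + 1 : ℕ) : ℝ) * c) ⊆ Icc 0 T := fun k hk =>
    Icc_subset_Icc (hmem k hk.le).1 (hmem (k + 1) hk).2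
  have hle : ∀ k : ℕ, (k : ℝ) * c ≤ ((k + 1 : ℕ) : ℝ) * c := fun k => by
    push_cast; nlinarith
  have hint : ∀ k < n + 1,
      IntervalIntegrable h volume ((k : ℝ) * c) (((k + 1 : ℕ) : ℝ) * c) := fun k hk =>
    (hh.mono (by rw [uIcc_of_le (hle k)]; exact hsub k hk)).intervalIntegrable
  have hsum := intervalIntegral.sum_integral_adjacent_intervals
    (a := fun k : ℕ => (k : ℝ) * c) hint
  simp only [Nat.cast_zero, zero_mul, hcT] at hsum
  rw [← hsum, Fin.sum_univ_eq_sum_range (fun i : ℕ => c • h (i * c)) (n + 1), dist_eq_norm,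
    ← Finset.sum_sub_distrib]
  have hlen : ∀ k : ℕ, ((k + 1 : ℕ) : ℝ) * c - k * c = c := fun k => by push_cast; ring
  calc ‖∑ k ∈ Finset.range (n + 1), (c • h (k * c) - ∫ t in (k : ℝ) * c..((k + 1 : ℕ) : ℝ) * c, h t)‖
      ≤ ∑ k ∈ Finset.range (n + 1), e / (2 * T) * c := by
        refine norm_sum_le_of_le _ fun k hk => ?_
        have hk' := Finset.mem_range.1 hk
        have : c • h (k * c) = ∫ t in (k : ℝ) * c..((k + 1 : ℕ) : ℝ) * c, h (k * c) := by
          rw [intervalIntegral.integral_const, hlen]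
        rw [this, ← intervalIntegral.integral_sub intervalIntegrable_const (hint k hk')]
        refine (intervalIntegral.norm_integral_le_of_norm_le_const
          (C := e / (2 * T)) fun t ht => ?_).trans_eq ?_
        · rw [uIoc_of_le (hle k)] at ht
          rw [← dist_eq_norm]
          refine (hdh _ (hmem k hk'.le) _ (hsub k hk' (Ioc_subset_Icc_self ht)) ?_).le
          rw [dist_comm, Real.dist_eq, abs_of_nonneg (by linarith [ht.1])]
          have := hlen k
          linarith [ht.2]
        · rw [hlen, abs_of_pos hc0]
    _ = e / 2 := by
        rw [Finset.sum_const, Finset.card_range, nsmul_eq_mul, ← hcT]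
        field_simp
    _ < e := by linarith

/-! ### Spectral bound for the covariance form on `[0, T]`. -/

section SpectralBound

open FourierTransform

/-- The factor `-(2π)⁻¹` converts the kernel `exp(iλt)` to the normalization `exp(-2πixξ)` of `𝓕`;
the change of variables it forces produces the `2π` in `d₀ = 2π f₀`. -/
theorem intervalIntegral_mul_exp_eq_fourier {T : ℝ} (hT : 0 < T) (φ : ℝ → ℝ) (l : ℝ) :
    ∫ t in (0 : ℝ)..T, (φ t : ℂ) * Complex.exp (Complex.I * l * t) =
      𝓕 ((Ioc 0 T).indicator fun t => (φ t : ℂ)) (-(2 * Real.pi)⁻¹ * l) := by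
  rw [Real.fourier_eq', intervalIntegral.integral_of_le hT.le, ← integral_indicator measurableSet_Ioc]
  congr 1 with t
  by_cases ht : t ∈ Ioc 0 T
  · rw [indicator_of_mem ht, indicator_of_mem ht, smul_eq_mul, mul_comm]
    congr 2
    have : (Real.pi : ℂ) ≠ 0 := by exact_mod_cast Real.pi_ne_zero
    simp only [RCLike.inner_apply, conj_trivial]
    push_cast
    field_simp
  · rw [indicator_of_notMem ht, indicator_of_notMem ht, smul_zero]

theorem memLp_indicator_of_continuousOn {T : ℝ} {φ : ℝ → ℝ} (hφ : ContinuousOn φ (Icc 0 T))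
    (p : ENNReal) : MemLp ((Ioc 0 T).indicator fun t => (φ t : ℂ)) p := by
  rw [memLp_indicator_iff_restrict measurableSet_Ioc]
  have hc : ContinuousOn (fun t => (φ t : ℂ)) (Icc 0 T) :=
    Complex.continuous_ofReal.comp_continuousOn hφ
  obtain ⟨C, hC⟩ := isCompact_Icc.exists_bound_of_continuousOn hc
  refine MemLp.of_bound ?_ C ?_
  · exact (hc.mono Ioc_subset_Icc_self).aestronglyMeasurable measurableSet_Ioc
  · filter_upwards [ae_restrict_mem measurableSet_Ioc] with t ht
    exact hC t (Ioc_subset_Icc_self ht)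

/-- The quadratic form of the covariance operator on `[0, T]`, in its spectral form, is bounded by
`2π sup f` times the squared `L²` norm. -/
theorem integral_norm_sq_mul_spectral_le {T : ℝ} (hT : 0 < T) {φ : ℝ → ℝ}
    (hφ : ContinuousOn φ (Icc 0 T)) {f : ℝ → ℝ} {f₀ : ℝ} (hf0 : ∀ l, 0 ≤ f l)
    (hf : ∀ l, f l ≤ f₀) :
    ∫ l : ℝ, ‖∫ t in (0 : ℝ)..T, (φ t : ℂ) * Complex.exp (Complex.I * l * t)‖ ^ 2 * f l ≤
      2 * Real.pi * f₀ * ∫ t in (0 : ℝ)..T, φ t ^ 2 := by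
  set Φ := (Ioc 0 T).indicator fun t => (φ t : ℂ)
  have h1 : Integrable Φ := memLp_one_iff_integrable.1 (memLp_indicator_of_continuousOn hφ 1)
  have h2 : MemLp Φ 2 := memLp_indicator_of_continuousOn hφ 2
  have hI : Integrable (fun x => ‖𝓕 Φ x‖ ^ 2) :=
    (memLp_two_iff_integrable_sq_norm (memLp_two_fourier h1 h2).1).1 (memLp_two_fourier h1 h2)
  have hc : (-(2 * Real.pi)⁻¹ : ℝ) ≠ 0 := by
    have := Real.pi_ne_zero
    simp [this]
  have hI' : Integrable (fun l => ‖𝓕 Φ (-(2 * Real.pi)⁻¹ * l)‖ ^ 2) :=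
    hI.comp_mul_left' hc
  have hval : ∫ l, ‖𝓕 Φ (-(2 * Real.pi)⁻¹ * l)‖ ^ 2 =
      2 * Real.pi * ∫ t in (0 : ℝ)..T, φ t ^ 2 := by
    rw [Measure.integral_comp_mul_left (fun x => ‖𝓕 Φ x‖ ^ 2), integral_norm_sq_fourier h1 h2,
      intervalIntegral.integral_of_le hT.le, ← integral_indicator measurableSet_Ioc]
    have hpi : |(-(2 * Real.pi)⁻¹ : ℝ)⁻¹| = 2 * Real.pi := by
      rw [inv_neg, inv_inv, abs_neg, abs_of_pos Real.two_pi_pos]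
    rw [hpi, smul_eq_mul]
    congr 2 with t
    by_cases ht : t ∈ Ioc 0 T
    · simp [Φ, ht]
    · simp [Φ, ht]
  simp_rw [intervalIntegral_mul_exp_eq_fourier hT]
  calc ∫ l, ‖𝓕 Φ (-(2 * Real.pi)⁻¹ * l)‖ ^ 2 * f l
      ≤ ∫ l, ‖𝓕 Φ (-(2 * Real.pi)⁻¹ * l)‖ ^ 2 * f₀ :=
        integral_mono_of_nonneg (ae_of_all _ fun l => mul_nonneg (by positivity) (hf0 l))
          (hI'.mul_const _) (ae_of_all _ fun l => mul_le_mul_of_nonneg_left (hf l) (by positivity))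
    _ = _ := by rw [integral_mul_const, hval]; ring

end SpectralBound

/-! ### Sub-Gaussianity of linear functionals of the noise. -/

section Noise

variable {Ω : Type*} [MeasurableSpace Ω] {P : Measure Ω} {ε : ℝ → Ω → ℝ} {f : ℝ → ℝ}

/-- The easy direction of Bochner's theorem: expand the squared modulus as `conj z * z` and
integrate term by term. It lets the variances of Riemann sums be followed under one integral in `l`.
-/
theorem quadForm_cov_eq_integral (hstat : IsStationaryCov P ε) (hs : IsSpectralDensity P ε f)
    {n : ℕ} (t Δ : Fin n → ℝ) :
    ∑ i, ∑ j, (∫ ω, ε (t i) ω * ε (t j) ω ∂P) * Δ i * Δ j =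
      ∫ l : ℝ, ‖∑ j, (Δ j : ℂ) * Complex.exp (Complex.I * l * t j)‖ ^ 2 * f l := by
  have hint : ∀ s : ℝ, Integrable (fun l : ℝ => Complex.exp (Complex.I * (l : ℂ) * (s : ℂ)) * (f l : ℂ)) :=
    fun s => by
      refine (hs.integrable.ofReal (𝕜 := ℂ)).bdd_mul (c := 1) (by fun_prop) (ae_of_all _ fun l => ?_)
      have : Complex.I * (l : ℂ) * (s : ℂ) = ((l * s : ℝ) : ℂ) * Complex.I := by push_cast; ring
      rw [this, Complex.norm_exp_ofReal_mul_I]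
  have hcov : ∀ i j, ((∫ ω, ε (t i) ω * ε (t j) ω ∂P : ℝ) : ℂ) =
      ∫ l : ℝ, Complex.exp (Complex.I * (l : ℂ) * ((t j - t i : ℝ) : ℂ)) * (f l : ℂ) := fun i j => by
    rw [← hs.cov_eq, ← hstat]; rfl
  rw [← Complex.ofReal_inj, ← integral_complex_ofReal]
  push_cast
  simp_rw [hcov]
  have hpt : ∀ l : ℝ, (‖∑ j, (Δ j : ℂ) * Complex.exp (Complex.I * l * t j)‖ : ℂ) ^ 2 * (f l : ℂ) =
      ∑ i, ∑ j, Complex.exp (Complex.I * (l : ℂ) * ((t j - t i : ℝ) : ℂ)) * (f l : ℂ) * Δ i * Δ j := by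
    intro l
    rw [← Complex.conj_mul', map_sum, Finset.sum_mul_sum, Finset.sum_mul]
    refine Finset.sum_congr rfl fun i _ => ?_
    rw [Finset.sum_mul]
    refine Finset.sum_congr rfl fun j _ => ?_
    rw [map_mul, ← Complex.exp_conj, map_mul, map_mul, Complex.conj_I, Complex.conj_ofReal,
      Complex.conj_ofReal, Complex.conj_ofReal]
    have : Complex.I * (l : ℂ) * ((t j - t i : ℝ) : ℂ) =
        -Complex.I * l * t i + Complex.I * l * t j := by push_cast; ring
    rw [this, Complex.exp_add]
    ring
  simp_rw [hpt]
  rw [integral_finsetSum _ fun i _ => integrable_finsetSum _ fun j _ =>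
    ((hint _).mul_const _).mul_const _]
  refine Finset.sum_congr rfl fun i _ => ?_
  rw [integral_finsetSum _ fun j _ => ((hint _).mul_const _).mul_const _]
  refine Finset.sum_congr rfl fun j _ => ?_
  rw [integral_mul_const, integral_mul_const]

theorem continuousOn_mul_of_continuous {T : ℝ} {φ : ℝ → ℝ} (hφ : ContinuousOn φ (Icc 0 T))
    {x : ℝ → ℝ} (hx : Continuous x) : ContinuousOn (fun t => x t * φ t) (Icc 0 T) :=
  hx.continuousOn.mul hφ

/-- The integral `∫₀ᵀ ε(t) φ(t) dt` of a strictly sub-Gaussian stationary process is sub-Gaussian,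
with variance proxy any upper bound of `2π (sup f) ∫₀ᵀ φ²`. -/
theorem hasSubgaussianMGF_integral (hN1 : IsCenteredContinuousProcess P ε)
    (hN2 : IsJointlyStrictlySubGaussian P ε) (hstat : IsStationaryCov P ε)
    (hs : IsSpectralDensity P ε f) {f₀ : ℝ} (hf : ∀ l, f l ≤ f₀) {T : ℝ} (hT : 0 < T)
    {φ : ℝ → ℝ} (hφ : ContinuousOn φ (Icc 0 T)) {V : NNReal}
    (hV : 2 * Real.pi * f₀ * ∫ t in (0 : ℝ)..T, φ t ^ 2 ≤ V) :
    ProbabilityTheory.HasSubgaussianMGF (fun ω => ∫ t in (0 : ℝ)..T, ε t ω * φ t) V P := by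
  -- The hypothesis speaks only of finitely many times, so the integral is approximated by Riemann
  -- sums.
  set S : ℕ → Ω → ℝ := fun n ω =>
    ∑ i : Fin (n + 1), (T / (n + 1)) • (ε (i * (T / (n + 1))) ω * φ (i * (T / (n + 1)))) with hS
  have hSm : ∀ n, Measurable (S n) := fun n =>
    Finset.measurable_fun_sum _ fun i _ =>
      ((hN1.measurable (i * (T / (n + 1)))).mul_const (φ (i * (T / (n + 1))))).const_mul _
  have hlim : ∀ᵐ ω ∂P, Tendsto (fun n => S n ω) atTop (𝓝 (∫ t in (0 : ℝ)..T, ε t ω * φ t)) := by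
    filter_upwards [hN1.ae_continuous] with ω hω
    exact tendsto_riemannSum hT (continuousOn_mul_of_continuous hφ hω)
  have hbm : AEMeasurable (fun ω => ∫ t in (0 : ℝ)..T, ε t ω * φ t) P :=
    aemeasurable_of_tendsto_metrizable_ae atTop (fun n => (hSm n).aemeasurable) hlim
  -- spectral representation of the variances of the Riemann sums
  set F : ℕ → ℝ → ℂ := fun n l => ∑ i : Fin (n + 1), (T / (n + 1)) •
    ((φ (i * (T / (n + 1))) : ℂ) * Complex.exp (Complex.I * l * ((i * (T / (n + 1)) : ℝ) : ℂ))) with hF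
  have hφc : ContinuousOn (fun t => (φ t : ℂ)) (Icc 0 T) :=
    Complex.continuous_ofReal.comp_continuousOn hφ
  have hFlim : ∀ l : ℝ, Tendsto (fun n => F n l) atTop
      (𝓝 (∫ t in (0 : ℝ)..T, (φ t : ℂ) * Complex.exp (Complex.I * l * t))) := fun l =>
    tendsto_riemannSum (h := fun t : ℝ => (φ t : ℂ) * Complex.exp (Complex.I * l * (t : ℂ))) hT
      (hφc.mul (by fun_prop))
  obtain ⟨C, hC⟩ := isCompact_Icc.exists_bound_of_continuousOn hφ
  have hC0 : 0 ≤ C := (norm_nonneg _).trans (hC 0 ⟨le_rfl, hT.le⟩)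
  have hFb : ∀ n l, ‖F n l‖ ≤ T * C := by
    intro n l
    have hn1 : (0 : ℝ) < n + 1 := by positivity
    simp only [hF]
    refine (norm_sum_le_of_le (n := fun _ => T / (n + 1) * C) _ fun i _ => ?_).trans_eq ?_
    · have hi : (i : ℝ) * (T / (n + 1)) ∈ Icc 0 T := by
        refine ⟨by positivity, ?_⟩
        have : (i : ℝ) ≤ n + 1 := by
          have := i.2; exact_mod_cast this.le
        calc (i : ℝ) * (T / (n + 1)) ≤ (n + 1) * (T / (n + 1)) := by gcongr
          _ = T := by field_simp
      have e : Complex.I * l * ((i * (T / (n + 1)) : ℝ) : ℂ) =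
        ((l * (i * (T / (n + 1))) : ℝ) : ℂ) * Complex.I := by push_cast; ring
      rw [norm_smul, norm_mul, e, Complex.norm_exp_ofReal_mul_I, mul_one, Complex.norm_real,
        Real.norm_of_nonneg (by positivity)]
      gcongr
      exact hC _ hi
    · rw [Finset.sum_const, Finset.card_univ, Fintype.card_fin, nsmul_eq_mul]
      push_cast
      field_simp
  set ψ : ℝ → ℂ := fun l => ∫ t in (0 : ℝ)..T, (φ t : ℂ) * Complex.exp (Complex.I * l * t)
  -- Each `‖F n l‖` is at most `T * C`, so `(T C)² f` dominates.
  have hvlim : Tendsto (fun n => ∫ l, ‖F n l‖ ^ 2 * f l) atTop (𝓝 (∫ l, ‖ψ l‖ ^ 2 * f l)) := by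
    refine tendsto_integral_of_dominated_convergence (fun l => (T * C) ^ 2 * f l) ?_
      (hs.integrable.const_mul _) ?_ ?_
    · intro n
      refine AEStronglyMeasurable.mul (Continuous.aestronglyMeasurable ?_)
        hs.integrable.aestronglyMeasurable
      fun_prop
    · intro n
      refine ae_of_all _ fun l => ?_
      rw [Real.norm_of_nonneg (mul_nonneg (by positivity) (hs.nonneg l))]
      have := hs.nonneg l
      gcongr
      exact hFb n l
    · exact ae_of_all _ fun l => ((hFlim l).norm.pow 2).mul_const _
  have hψ : ∫ l, ‖ψ l‖ ^ 2 * f l ≤ V :=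
    (integral_norm_sq_mul_spectral_le hT hφ hs.nonneg hf).trans hV
  have hmgf : ∀ n (x : ℝ), ∫⁻ ω, ENNReal.ofReal (Real.exp (x * S n ω)) ∂P ≤
      ENNReal.ofReal (Real.exp (1 / 2 * (x ^ 2 * ∫ l, ‖F n l‖ ^ 2 * f l))) := by
    intro n x
    obtain ⟨hi, hle⟩ := hN2 (n + 1) (fun i => i * (T / (n + 1)))
      (fun i => x * (T / (n + 1) * φ (i * (T / (n + 1)))))
    have e : ∀ ω, ∑ i : Fin (n + 1), ε (i * (T / (n + 1))) ω *
        (x * (T / (n + 1) * φ (i * (T / (n + 1))))) = x * S n ω := fun ω => by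
      rw [hS, Finset.mul_sum]
      exact Finset.sum_congr rfl fun i _ => by rw [smul_eq_mul]; ring
    simp only [e] at hi hle
    rw [← ofReal_integral_eq_lintegral_ofReal hi (ae_of_all _ fun ω => (Real.exp_pos _).le)]
    refine ENNReal.ofReal_le_ofReal (hle.trans_eq ?_)
    rw [quadForm_cov_eq_integral hstat hs, ← integral_const_mul (x ^ 2)]
    refine congrArg (fun y => Real.exp (1 / 2 * y)) (integral_congr_ae (ae_of_all _ fun l => ?_))
    dsimp only
    have : ∑ j : Fin (n + 1), ((x * (T / (n + 1) * φ (j * (T / (n + 1)))) : ℝ) : ℂ) *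
        Complex.exp (Complex.I * l * ((j * (T / (n + 1)) : ℝ) : ℂ)) = x * F n l := by
      rw [hF, Finset.mul_sum]
      refine Finset.sum_congr rfl fun i _ => ?_
      rw [Complex.real_smul]; push_cast; ring
    rw [this, norm_mul, Complex.norm_real, mul_pow, Real.norm_eq_abs, sq_abs]
    ring
  -- Fatou's lemma carries the exponential bound to the limit, and gives integrability as well;
  -- hence the use of `∫⁻`.
  have hmain : ∀ x : ℝ, ∫⁻ ω, ENNReal.ofReal (Real.exp (x * ∫ t in (0 : ℝ)..T, ε t ω * φ t)) ∂P ≤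
      ENNReal.ofReal (Real.exp (V * x ^ 2 / 2)) := by
    intro x
    calc ∫⁻ ω, ENNReal.ofReal (Real.exp (x * ∫ t in (0 : ℝ)..T, ε t ω * φ t)) ∂P
        = ∫⁻ ω, liminf (fun n => ENNReal.ofReal (Real.exp (x * S n ω))) atTop ∂P := by
          refine lintegral_congr_ae ?_
          filter_upwards [hlim] with ω hω
          exact (ENNReal.tendsto_ofReal
            ((Real.continuous_exp.tendsto _).comp (hω.const_mul x))).liminf_eq.symm
      _ ≤ liminf (fun n => ∫⁻ ω, ENNReal.ofReal (Real.exp (x * S n ω)) ∂P) atTop :=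
          lintegral_liminf_le fun n => ((hSm n).const_mul x).exp.ennreal_ofReal
      _ ≤ liminf (fun n => ENNReal.ofReal
            (Real.exp (1 / 2 * (x ^ 2 * ∫ l, ‖F n l‖ ^ 2 * f l)))) atTop :=
          liminf_le_liminf (Eventually.of_forall fun n => hmgf n x)
      _ = ENNReal.ofReal (Real.exp (1 / 2 * (x ^ 2 * ∫ l, ‖ψ l‖ ^ 2 * f l))) :=
          (ENNReal.tendsto_ofReal ((Real.continuous_exp.tendsto _).comp
            ((hvlim.const_mul _).const_mul _))).liminf_eq
      _ ≤ _ := by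
          refine ENNReal.ofReal_le_ofReal (Real.exp_le_exp.2 ?_)
          nlinarith [mul_le_mul_of_nonneg_left hψ (sq_nonneg x)]
  have hae : ∀ x : ℝ, AEStronglyMeasurable
      (fun ω => Real.exp (x * ∫ t in (0 : ℝ)..T, ε t ω * φ t)) P := fun x =>
    (hbm.const_mul x).exp.aestronglyMeasurable
  refine ⟨fun x => ⟨hae x, ?_⟩, fun x => ?_⟩
  · rw [hasFiniteIntegral_iff_ofReal (ae_of_all _ fun ω => (Real.exp_pos _).le)]
    exact (hmain x).trans_lt ENNReal.ofReal_lt_top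
  · rw [ProbabilityTheory.mgf,
      integral_eq_lintegral_of_nonneg_ae (ae_of_all _ fun ω => (Real.exp_pos _).le) (hae x)]
    exact ENNReal.toReal_le_of_le_ofReal (Real.exp_pos _).le (hmain x)

end Noise

/-! ### Finite nets in bounded sets. -/

section Nets

variable {q : ℕ}

theorem norm_le_of_forall_abs_le {x : EuclideanSpace ℝ (Fin q)} {h : ℝ} (hh : 0 ≤ h)
    (hx : ∀ i, |x i| ≤ h) : ‖x‖ ≤ (q + 1) * h := by
  rw [EuclideanSpace.norm_eq]
  refine Real.sqrt_le_iff.2 ⟨by positivity, ?_⟩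
  calc ∑ i, ‖x i‖ ^ 2 ≤ ∑ _i : Fin q, h ^ 2 :=
        Finset.sum_le_sum fun i _ => by
          rw [Real.norm_eq_abs]; exact pow_le_pow_left₀ (abs_nonneg _) (hx i) 2
    _ = q * h ^ 2 := by simp
    _ ≤ ((q + 1) * h) ^ 2 := by
        have : (0 : ℝ) ≤ q := Nat.cast_nonneg q
        nlinarith [sq_nonneg h, mul_nonneg this (sq_nonneg h),
          mul_nonneg (mul_nonneg this this) (sq_nonneg h)]

/-- A subset of the ball of radius `M` in `ℝ^q` has an internal `r`-net of cardinality at most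
`((2 q + 4) M / r) ^ q`, given here as the image of a projection onto the net. -/
theorem exists_net {S : Set (EuclideanSpace ℝ (Fin q))} {M r : ℝ} (hr : 0 < r) (hrM : r ≤ M)
    (hS : ∀ x ∈ S, ‖x‖ ≤ M) :
    ∃ π : EuclideanSpace ℝ (Fin q) → EuclideanSpace ℝ (Fin q),
      (∀ u ∈ S, π u ∈ S ∧ ‖u - π u‖ ≤ r) ∧ (π '' S).Finite ∧
        ((π '' S).ncard : ℝ) ≤ ((2 * q + 4) * M / r) ^ q := by
  classical
  have hM : 0 < M := hr.trans_le hrM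
  -- Points of one cubic cell of side `h` differ by at most `(q + 1) h = r` in norm; `q + 1` is a
  -- crude substitute for `√q` that also covers `q = 0`.
  set h := r / (q + 1) with hh
  have hh0 : 0 < h := by positivity
  set cell : EuclideanSpace ℝ (Fin q) → Fin q → ℤ := fun x i => ⌊x i / h⌋ with hcell
  -- One representative from `S` itself in each occupied cell: the net must lie in `S`, because the
  -- Hölder bound holds only there.
  set G : (Fin q → ℤ) → EuclideanSpace ℝ (Fin q) := fun c =>
    if hc : ∃ v ∈ S, cell v = c then hc.choose else 0 with hG
  have hGspec : ∀ u ∈ S, G (cell u) ∈ S ∧ cell (G (cell u)) = cell u := by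
    intro u hu
    have hc : ∃ v ∈ S, cell v = cell u := ⟨u, hu, rfl⟩
    have e : G (cell u) = hc.choose := dif_pos hc
    rw [e]
    exact hc.choose_spec
  set B : Finset (Fin q → ℤ) := Fintype.piFinset fun _ => Finset.Icc ⌊-M / h⌋ ⌊M / h⌋ with hB
  have hsub : (fun u => G (cell u)) '' S ⊆ G '' (B : Set (Fin q → ℤ)) := by
    rintro _ ⟨u, hu, rfl⟩
    refine ⟨cell u, ?_, rfl⟩
    rw [Finset.mem_coe, hB, Fintype.mem_piFinset]
    intro i
    have hi : |u i| ≤ M := by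
      rw [← Real.norm_eq_abs]; exact (PiLp.norm_apply_le u i).trans (hS u hu)
    rw [abs_le] at hi
    rw [Finset.mem_Icc]
    exact ⟨Int.floor_le_floor (by gcongr; exact hi.1), Int.floor_le_floor (by gcongr; exact hi.2)⟩
  have hfin : (G '' (B : Set (Fin q → ℤ))).Finite := B.finite_toSet.image _
  refine ⟨fun u => G (cell u), fun u hu => ⟨(hGspec u hu).1, ?_⟩, hfin.subset hsub, ?_⟩
  · have : r = (q + 1) * h := by rw [hh]; field_simp
    rw [this]
    refine norm_le_of_forall_abs_le hh0.le fun i => ?_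
    have hc := congrFun (hGspec u hu).2 i
    have := (Int.abs_sub_lt_one_of_floor_eq_floor hc).le
    rw [← sub_div, abs_div, abs_of_pos hh0, div_le_one hh0, abs_sub_comm] at this
    simpa using this
  · have h1 : (((fun u => G (cell u)) '' S).ncard : ℝ) ≤ B.card := by
      have := (ncard_le_ncard hsub hfin).trans (ncard_image_le B.finite_toSet)
      rw [ncard_coe_finset] at this
      exact_mod_cast this
    refine h1.trans ?_
    rw [hB, Fintype.card_piFinset]
    simp only [Finset.prod_const, Finset.card_univ, Fintype.card_fin, Int.card_Icc]
    push_cast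
    -- At most `2M/h + 2 = 2(q+1)M/r + 2` cells per coordinate, and `2 ≤ 2M/r`.
    have hcount : (((⌊M / h⌋ + 1 - ⌊-M / h⌋).toNat : ℕ) : ℝ) ≤ (2 * q + 4) * M / r := by
      have hle : ⌊-M / h⌋ ≤ ⌊M / h⌋ := Int.floor_le_floor (by gcongr; linarith)
      have e : (((⌊M / h⌋ + 1 - ⌊-M / h⌋).toNat : ℕ) : ℝ) =
          ((⌊M / h⌋ + 1 - ⌊-M / h⌋ : ℤ) : ℝ) := by
        rw [← Int.cast_natCast, Int.toNat_of_nonneg (by linarith)]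
      rw [e]
      push_cast
      have a1 := Int.floor_le (M / h)
      have a2 := Int.lt_floor_add_one (-M / h)
      have a3 : M / h = (q + 1) * (M / r) := by rw [hh]; field_simp
      have a4 : -M / h = -((q + 1) * (M / r)) := by rw [neg_div, a3]
      have a5 : 1 ≤ M / r := (one_le_div hr).2 hrM
      rw [mul_div_assoc]
      rw [a3] at a1
      rw [a4] at a2
      rw [a3, a4]
      linarith
    exact pow_le_pow_left₀ (by positivity) hcount q

end Nets

/-! ### Chaining. -/

section Chaining

/-- At level `k` the number of links grows like a power of `4 ^ k` while each fails with probability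
of order `exp(-4 ^ k)`. Comparison with a geometric series comes from `exp x ≥ x^(a+1)/(a+1)!`. -/
theorem summable_pow_mul_exp_neg_pow (a : ℕ) :
    Summable fun k : ℕ => ((4 : ℝ) ^ (k + 1)) ^ a * Real.exp (-(4 : ℝ) ^ k) := by
  have hs : Summable fun k : ℕ => ((4 : ℝ) ^ a * (a + 1).factorial) * (1 / 4 : ℝ) ^ k :=
    (summable_geometric_of_lt_one (by norm_num) (by norm_num)).mul_left _
  refine Summable.of_nonneg_of_le (fun k => by positivity) (fun k => ?_) hs
  have h4 : (0 : ℝ) < 4 ^ k := by positivity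
  have h1 := Real.pow_div_factorial_le_exp ((4 : ℝ) ^ k) h4.le (a + 1)
  have hf : (0 : ℝ) < (a + 1).factorial := by positivity
  rw [div_le_iff₀ hf] at h1
  rw [Real.exp_neg, ← div_eq_mul_inv, div_le_iff₀ (Real.exp_pos _), one_div, inv_pow, pow_succ 4 k,
    mul_pow]
  have h2 : ((4 : ℝ) ^ k) ^ a = ((4 : ℝ) ^ k) ^ (a + 1) * ((4 : ℝ) ^ k)⁻¹ := by
    rw [pow_succ, mul_assoc, mul_inv_cancel₀ h4.ne', mul_one]
  rw [h2]
  have : (0 : ℝ) < 4 ^ a * ((4 : ℝ) ^ k)⁻¹ := by positivity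
  nlinarith [mul_le_mul_of_nonneg_left h1 this.le]

variable {Ω : Type*} [MeasurableSpace Ω] {P : Measure Ω} [IsProbabilityMeasure P] {q : ℕ}

/-- Chaining bound: if the increments of a continuous process have sub-Gaussian tails with scale
`√K ‖u - v‖ ^ ρ`, then on a bounded set the process is, up to probability `const · exp (-G)`,
within distance one of its values on a net of mesh `η ^ J / 2`, as soon as
`8 K η² (G + 1) ≤ 1`. -/
theorem exists_net_measure_oscillation_le {S : Set (EuclideanSpace ℝ (Fin q))} {M : ℝ} (hM : 1 ≤ M)
    (hS : ∀ x ∈ S, ‖x‖ ≤ M) {b : EuclideanSpace ℝ (Fin q) → Ω → ℝ} {κ ρ K η G : ℝ}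
    (hρ : 0 ≤ ρ) {J : ℕ} (hJ : 1 ≤ J) (hJρ : 1 ≤ J * ρ) (hK : 0 < K)
    (htail : ∀ u ∈ S, ∀ v ∈ S, ∀ y, 0 < y → ‖u - v‖ ≤ κ → ‖u - v‖ ^ ρ ≤ y → ∀ x, 0 ≤ x →
      P.real {ω | x ≤ b u ω - b v ω} ≤ Real.exp (-x ^ 2 / (2 * (K * y ^ 2))))
    (hcont : ∀ᵐ ω ∂P, ContinuousOn (fun u => b u ω) S)
    (hη : 0 < η) (hη1 : η ≤ 1) (hηκ : η ≤ κ) (hG : 0 ≤ G) (hηG : 8 * K * η ^ 2 * (G + 1) ≤ 1) :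
    ∃ π : EuclideanSpace ℝ (Fin q) → EuclideanSpace ℝ (Fin q),
      (∀ u ∈ S, π u ∈ S ∧ ‖u - π u‖ ≤ η ^ J) ∧ (π '' S).Finite ∧
      ((π '' S).ncard : ℝ) ≤ (2 * (2 * q + 4) * M / η ^ J) ^ q ∧
      P.real {ω | ∃ u ∈ S, 1 < b u ω - b (π u) ω} ≤
        (2 * (2 * q + 4) * M / η ^ J) ^ (2 * q) *
          (∑' k : ℕ, ((4 : ℝ) ^ (k + 1)) ^ (J * (2 * q)) * Real.exp (-(4 : ℝ) ^ k)) *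
          Real.exp (-G) := by
  -- Since `J ρ ≥ 1`, the `ρ`-th power of this distance is at most `η / 4 ^ k`. The nets below have
  -- mesh `D k / 2`, so consecutive net points are within `D k`.
  set D : ℕ → ℝ := fun k => (η / 4 ^ k) ^ J with hD
  have hD0 : ∀ k, 0 < D k := fun k => by positivity
  have hyle : ∀ k : ℕ, η / 4 ^ k ≤ η := fun k => div_le_self hη.le (one_le_pow₀ (by norm_num))
  have hDη : ∀ k, D k ≤ η / 4 ^ k := fun k =>
    pow_le_of_le_one (by positivity) ((hyle k).trans hη1) (by omega)
  have hDanti : ∀ k, D (k + 1) ≤ D k := fun k => by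
    rw [hD]
    dsimp only
    gcongr
    · norm_num
    · omega
  have hnet := fun k => exists_net (S := S) (M := M) (r := D k / 2) (by have := hD0 k; positivity)
    (by have := hDη k; have := hyle k; have := hD0 k; linarith) hS
  choose π hπ hfin hcard using hnet
  set X : ℕ → ℝ := fun k => (2 * q + 4) * M / (D k / 2) with hX
  have hX0 : ∀ k, 0 ≤ X k := fun k => by have := hD0 k; positivity
  have hXmono : ∀ k, X k ≤ X (k + 1) := fun k => by
    rw [hX]
    dsimp only
    have := hD0 (k + 1)
    have := hDanti k
    gcongr
  have hXeq : ∀ k, X k = 2 * (2 * q + 4) * M / η ^ J * ((4 : ℝ) ^ k) ^ J := fun k => by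
    rw [hX, hD]
    dsimp only
    rw [div_pow]
    field_simp
  have hX0eq : X 0 = 2 * (2 * q + 4) * M / η ^ J := by rw [hXeq]; simp
  -- The thresholds `2^{-(k+1)}` sum to 1, the allowed oscillation.
  set A : ℕ → Set Ω := fun k =>
    {ω | ∃ u ∈ S, (1 / 2 : ℝ) ^ (k + 1) ≤ b (π (k + 1) u) ω - b (π k u) ω} with hA
  set Z : ℕ → ℝ := fun k => ((4 : ℝ) ^ (k + 1)) ^ (J * (2 * q)) * Real.exp (-(4 : ℝ) ^ k) with hZ
  set L : ℝ := (2 * (2 * q + 4) * M / η ^ J) ^ (2 * q) with hL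
  have hL0 : 0 ≤ L := by positivity
  have hAk : ∀ k, P (A k) ≤ ENNReal.ofReal (L * Z k * Real.exp (-G)) := by
    intro k
    set N : Set (EuclideanSpace ℝ (Fin q) × EuclideanSpace ℝ (Fin q)) :=
      (fun u => (π (k + 1) u, π k u)) '' S with hN
    have hNsub : N ⊆ (π (k + 1) '' S) ×ˢ (π k '' S) := by
      rintro _ ⟨u, hu, rfl⟩
      exact ⟨⟨u, hu, rfl⟩, ⟨u, hu, rfl⟩⟩
    have hNfin : N.Finite := ((hfin (k + 1)).prod (hfin k)).subset hNsub
    have hNcard : (N.ncard : ℝ) ≤ L * ((4 : ℝ) ^ (k + 1)) ^ (J * (2 * q)) := by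
      have h1 := ncard_le_ncard hNsub ((hfin (k + 1)).prod (hfin k))
      rw [ncard_prod] at h1
      calc (N.ncard : ℝ) ≤ ((π (k + 1) '' S).ncard : ℝ) * ((π k '' S).ncard : ℝ) := by
            exact_mod_cast h1
        _ ≤ X (k + 1) ^ q * X (k + 1) ^ q := by
            have c1 := hcard (k + 1)
            have c2 := (hcard k).trans (pow_le_pow_left₀ (hX0 k) (hXmono k) q)
            exact mul_le_mul c1 c2 (by positivity) (pow_nonneg (hX0 _) _)
        _ = L * ((4 : ℝ) ^ (k + 1)) ^ (J * (2 * q)) := by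
            rw [← pow_add, ← two_mul, hXeq, mul_pow, ← pow_mul _ J]
    have hsub : A k ⊆ ⋃ p ∈ hNfin.toFinset, {ω | (1 / 2 : ℝ) ^ (k + 1) ≤ b p.1 ω - b p.2 ω} := by
      rintro ω ⟨u, hu, hω⟩
      simp only [mem_iUnion]
      exact ⟨(π (k + 1) u, π k u), by rw [Finite.mem_toFinset]; exact ⟨u, hu, rfl⟩, hω⟩
    have hp : ∀ p ∈ hNfin.toFinset, P {ω | (1 / 2 : ℝ) ^ (k + 1) ≤ b p.1 ω - b p.2 ω} ≤
        ENNReal.ofReal (Real.exp (-(4 : ℝ) ^ k) * Real.exp (-G)) := by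
      intro p hp
      rw [Finite.mem_toFinset] at hp
      obtain ⟨u, hu, rfl⟩ := hp
      have hd : ‖π (k + 1) u - π k u‖ ≤ D k := by
        have e : π (k + 1) u - π k u = (u - π k u) - (u - π (k + 1) u) := by abel
        rw [e]
        have := (hπ k u hu).2
        have := (hπ (k + 1) u hu).2
        have := hDanti k
        exact (norm_sub_le _ _).trans (by linarith)
      have hy : ‖π (k + 1) u - π k u‖ ^ ρ ≤ η / 4 ^ k := by
        refine (Real.rpow_le_rpow (norm_nonneg _) hd hρ).trans ?_
        rw [hD]
        dsimp only
        rw [← Real.rpow_natCast, ← Real.rpow_mul (by positivity)]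
        exact Real.rpow_le_self_of_le_one (by positivity) ((hyle k).trans hη1) hJρ
      have ht := htail _ (hπ (k + 1) u hu).1 _ (hπ k u hu).1 (η / 4 ^ k) (by positivity)
        (hd.trans ((hDη k).trans ((hyle k).trans hηκ))) hy ((1 / 2 : ℝ) ^ (k + 1)) (by positivity)
      rw [← ENNReal.ofReal_toReal (measure_ne_top P _)]
      refine ENNReal.ofReal_le_ofReal (ht.trans ?_)
      rw [← Real.exp_add]
      refine Real.exp_le_exp.2 ?_
      have e : -((1 / 2 : ℝ) ^ (k + 1)) ^ 2 / (2 * (K * (η / 4 ^ k) ^ 2)) =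
          -(4 ^ k / (8 * K * η ^ 2)) := by
        have h24 : (4 : ℝ) ^ k = 2 ^ k * 2 ^ k := by rw [← mul_pow]; norm_num
        rw [h24, one_div, inv_pow, pow_succ]
        field_simp
        ring
      have h4 : (1 : ℝ) ≤ 4 ^ k := one_le_pow₀ (by norm_num)
      -- Since `(G + 1) 4^k ≥ 4^k + G`, one part pays for the number of links and the other leaves
      -- `exp(-G)`.
      have hq : (G + 1) * 4 ^ k ≤ 4 ^ k / (8 * K * η ^ 2) := by
        rw [le_div_iff₀ (by positivity)]
        nlinarith [mul_le_mul_of_nonneg_left hηG (by positivity : (0 : ℝ) ≤ 4 ^ k)]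
      rw [e]
      nlinarith
    calc P (A k) ≤ ∑ p ∈ hNfin.toFinset, P {ω | (1 / 2 : ℝ) ^ (k + 1) ≤ b p.1 ω - b p.2 ω} :=
          (measure_mono hsub).trans (measure_biUnion_finset_le _ _)
      _ ≤ ∑ _p ∈ hNfin.toFinset, ENNReal.ofReal (Real.exp (-(4 : ℝ) ^ k) * Real.exp (-G)) :=
          Finset.sum_le_sum hp
      _ = ENNReal.ofReal (N.ncard * (Real.exp (-(4 : ℝ) ^ k) * Real.exp (-G))) := by
          rw [Finset.sum_const, nsmul_eq_mul, ncard_eq_toFinset_card N hNfin,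
            ENNReal.ofReal_mul (p := (hNfin.toFinset.card : ℝ)) (by positivity),
            ENNReal.ofReal_natCast]
      _ ≤ _ := by
          refine ENNReal.ofReal_le_ofReal ?_
          rw [hZ]
          dsimp only
          calc _ ≤ L * ((4 : ℝ) ^ (k + 1)) ^ (J * (2 * q)) *
                (Real.exp (-(4 : ℝ) ^ k) * Real.exp (-G)) := by gcongr
            _ = _ := by ring
  refine ⟨π 0, fun u hu => ⟨(hπ 0 u hu).1, (hπ 0 u hu).2.trans ?_⟩, hfin 0,
    (hcard 0).trans_eq (by rw [← hX0eq]), ?_⟩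
  · have : D 0 = η ^ J := by simp [hD]
    have := hD0 0
    linarith
  have hsubset : {ω | ∃ u ∈ S, 1 < b u ω - b (π 0 u) ω} ⊆
      {ω | ¬ ContinuousOn (fun u => b u ω) S} ∪ ⋃ k, A k := by
    rintro ω ⟨u, hu, hω⟩
    by_contra hcon
    simp only [mem_union, mem_ofPred_eq, mem_iUnion, not_or, not_not, not_exists] at hcon
    obtain ⟨hc, hnA⟩ := hcon
    have hstep : ∀ k, b (π (k + 1) u) ω - b (π k u) ω ≤ (1 / 2 : ℝ) ^ (k + 1) := fun k => by
      by_contra! hlt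
      exact hnA k ⟨u, hu, hlt.le⟩
    have hind : ∀ n, b (π n u) ω - b (π 0 u) ω ≤ 1 - (1 / 2 : ℝ) ^ n := by
      intro n
      induction n with
      | zero => simp
      | succ n ih =>
        have := hstep n
        have e : (1 / 2 : ℝ) ^ n = 2 * (1 / 2 : ℝ) ^ (n + 1) := by rw [pow_succ]; ring
        linarith
    have hπlim : Tendsto (fun n => π n u) atTop (𝓝[S] u) := by
      refine tendsto_nhdsWithin_iff.2 ⟨?_, Eventually.of_forall fun n => (hπ n u hu).1⟩
      rw [tendsto_iff_norm_sub_tendsto_zero]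
      have hto : Tendsto (fun n : ℕ => η / 4 ^ n) atTop (𝓝 0) :=
        tendsto_const_nhds.div_atTop (tendsto_pow_atTop_atTop_of_one_lt (by norm_num))
      refine squeeze_zero (fun n => norm_nonneg _) (fun n => ?_) hto
      rw [norm_sub_rev]
      have := (hπ n u hu).2
      have := hDη n
      have := hD0 n
      linarith
    have hblim := (hc u hu).tendsto.comp hπlim
    have hle : b u ω ≤ b (π 0 u) ω + 1 := le_of_tendsto' hblim fun n => by
      have := hind n
      have : (0 : ℝ) ≤ (1 / 2 : ℝ) ^ n := by positivity
      simp only [Function.comp_apply]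
      linarith
    linarith
  have hsumm : Summable fun k => L * Z k * Real.exp (-G) :=
    ((summable_pow_mul_exp_neg_pow (J * (2 * q))).mul_left L).mul_right _
  have htsum : ∑' k, L * Z k * Real.exp (-G) = L * (∑' k, Z k) * Real.exp (-G) := by
    rw [tsum_mul_right, tsum_mul_left]
  rw [← htsum]
  have hnn : ∀ k, 0 ≤ L * Z k * Real.exp (-G) := fun k => by positivity
  refine ENNReal.toReal_le_of_le_ofReal (tsum_nonneg hnn) ?_
  calc P {ω | ∃ u ∈ S, 1 < b u ω - b (π 0 u) ω}
      ≤ P {ω | ¬ ContinuousOn (fun u => b u ω) S} + P (⋃ k, A k) :=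
        (measure_mono hsubset).trans (measure_union_le _ _)
    _ = P (⋃ k, A k) := by rw [ae_iff.1 hcont, zero_add]
    _ ≤ ∑' k, P (A k) := measure_iUnion_le _
    _ ≤ ∑' k, ENNReal.ofReal (L * Z k * Real.exp (-G)) := ENNReal.tsum_le_tsum hAk
    _ = _ := (ENNReal.ofReal_tsum_of_nonneg hnn hsumm).symm

end Chaining

/-- Cauchy–Schwarz, from the discriminant of `s ↦ ∫ (x - s y)²`. -/
theorem sq_intervalIntegral_mul_le {T : ℝ} (hT : 0 ≤ T) {x y : ℝ → ℝ}
    (hx : ContinuousOn x (Icc 0 T)) (hy : ContinuousOn y (Icc 0 T)) :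
    (∫ t in (0 : ℝ)..T, x t * y t) ^ 2 ≤
      (∫ t in (0 : ℝ)..T, x t ^ 2) * ∫ t in (0 : ℝ)..T, y t ^ 2 := by
  have hu : uIcc 0 T = Icc 0 T := uIcc_of_le hT
  have ixx : IntervalIntegrable (fun t => x t ^ 2) volume 0 T :=
    ContinuousOn.intervalIntegrable (by rw [hu]; exact hx.pow 2)
  have iyy : IntervalIntegrable (fun t => y t ^ 2) volume 0 T :=
    ContinuousOn.intervalIntegrable (by rw [hu]; exact hy.pow 2)
  have ixy : IntervalIntegrable (fun t => x t * y t) volume 0 T :=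
    ContinuousOn.intervalIntegrable (by rw [hu]; exact hx.mul hy)
  have key : ∀ s : ℝ, 0 ≤ (∫ t in (0 : ℝ)..T, y t ^ 2) * (s * s) +
      (-2 * ∫ t in (0 : ℝ)..T, x t * y t) * s + ∫ t in (0 : ℝ)..T, x t ^ 2 := by
    intro s
    have h0 : 0 ≤ ∫ t in (0 : ℝ)..T, (x t - s * y t) ^ 2 :=
      intervalIntegral.integral_nonneg hT fun t _ => sq_nonneg _
    have e : ∫ t in (0 : ℝ)..T, (x t - s * y t) ^ 2 =
        ∫ t in (0 : ℝ)..T, (s * s * y t ^ 2 + (-2 * s) * (x t * y t) + x t ^ 2) := by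
      congr 1 with t; ring
    rw [e, intervalIntegral.integral_add ((iyy.const_mul _).add (ixy.const_mul _)) ixx,
      intervalIntegral.integral_add (iyy.const_mul _) (ixy.const_mul _),
      intervalIntegral.integral_const_mul, intervalIntegral.integral_const_mul] at h0
    linarith
  have := discrim_le_zero key
  rw [discrim] at this
  nlinarith

/-! ### Geometry of `U_T` and the least squares inequality. -/

section Model

variable {q : ℕ}

theorem diagMul_inv_diagMul {c : Fin q → ℝ} (hc : ∀ i, 0 < c i) (x : EuclideanSpace ℝ (Fin q)) :
    diagMul (fun i => (c i)⁻¹) (diagMul c x) = x := by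
  ext i
  simp only [diagMul]
  rw [inv_mul_cancel_left₀ (hc i).ne']

theorem diagMul_smul (c : Fin q → ℝ) (s : ℝ) (x : EuclideanSpace ℝ (Fin q)) :
    diagMul c (s • x) = s • diagMul c x := by
  ext i
  simp only [diagMul, PiLp.smul_apply, smul_eq_mul]
  ring

theorem diagMul_zero (c : Fin q → ℝ) : diagMul c (0 : EuclideanSpace ℝ (Fin q)) = 0 := by
  ext i
  simp [diagMul]

variable {Θ : Set (EuclideanSpace ℝ (Fin q))} {θ : EuclideanSpace ℝ (Fin q)}
  {a : ℝ → EuclideanSpace ℝ (Fin q) → ℝ} {T : ℝ}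

theorem mem_closure_of_mem_localSet (hd : ∀ i, 0 < normCoeff a θ T i)
    {u : EuclideanSpace ℝ (Fin q)} (hu : u ∈ localSet a Θ θ T) :
    θ + diagMul (fun i => (normCoeff a θ T i)⁻¹) u ∈ closure Θ := by
  obtain ⟨τ, hτ, rfl⟩ := hu
  dsimp only
  rwa [diagMul_inv_diagMul hd, add_sub_cancel]

theorem zero_mem_localSet (hθ : θ ∈ Θ) : (0 : EuclideanSpace ℝ (Fin q)) ∈ localSet a Θ θ T :=
  ⟨θ, subset_closure hθ, by dsimp only; rw [sub_self, diagMul_zero]⟩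

theorem increment_zero (t : ℝ) : increment a θ T t 0 = 0 := by
  rw [increment, diagMul_zero, add_zero, sub_self]

theorem smul_mem_localSet (hΘ : Convex ℝ Θ) (hθ : θ ∈ Θ) {u : EuclideanSpace ℝ (Fin q)}
    (hu : u ∈ localSet a Θ θ T) {s : ℝ} (hs : s ∈ Icc (0 : ℝ) 1) : s • u ∈ localSet a Θ θ T := by
  obtain ⟨τ, hτ, rfl⟩ := hu
  refine ⟨θ + s • (τ - θ), hΘ.closure.add_smul_sub_mem (subset_closure hθ) hτ hs, ?_⟩
  dsimp only
  rw [add_sub_cancel_left, diagMul_smul]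

/-- The set `U_T` is star-shaped, so it meets a shell as soon as it has points beyond it. -/
theorem shell_nonempty_of_mem_localSet (hΘ : Convex ℝ Θ) (hθ : θ ∈ Θ) {R : ℝ} (hR : 0 < R)
    {u : EuclideanSpace ℝ (Fin q)} (hu : u ∈ localSet a Θ θ T) (hRu : R ≤ ‖u‖) :
    (shell a Θ θ T R).Nonempty := by
  have hu0 : 0 < ‖u‖ := hR.trans_le hRu
  have hn : ‖(R / ‖u‖) • u‖ = R := by
    rw [norm_smul, Real.norm_of_nonneg (by positivity), div_mul_cancel₀ _ hu0.ne']
  refine ⟨(R / ‖u‖) • u, smul_mem_localSet hΘ hθ hu ⟨by positivity, (div_le_one hu0).2 hRu⟩, ?_⟩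
  simp only [mem_ofPred_eq, hn]
  exact ⟨le_rfl, by linarith⟩

theorem normCoeff_mono {T' : ℝ} (hT : 0 ≤ T) (hTT' : T ≤ T') (i : Fin q)
    (hint : IntervalIntegrable (fun t => (partialDeriv a θ i t) ^ 2) volume 0 T') :
    normCoeff a θ T i ≤ normCoeff a θ T' i :=
  Real.sqrt_le_sqrt <| intervalIntegral.integral_mono_interval le_rfl hT hTT'
    (ae_of_all _ fun _ => sq_nonneg _) hint

/-- The sets `U_T` are uniformly bounded for bounded `T`. -/
theorem exists_norm_le_of_mem_localSet (hΘ : Bornology.IsBounded Θ) {T' : ℝ}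
    (hint : ∀ i, IntervalIntegrable (fun t => (partialDeriv a θ i t) ^ 2) volume 0 T') :
    ∃ M, ∀ T, 0 ≤ T → T ≤ T' → ∀ u ∈ localSet a Θ θ T, ‖u‖ ≤ M := by
  obtain ⟨C, hC⟩ := hΘ.closure.exists_norm_le
  have hd0 : ∀ i, 0 ≤ normCoeff a θ T' i := fun i => Real.sqrt_nonneg _
  -- The normalizations increase with `T`, so those at `T'` serve all smaller `T`.
  refine ⟨(q + 1) * ((∑ i, normCoeff a θ T' i) * (|C| + ‖θ‖)), fun T hT hTT' u hu => ?_⟩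
  obtain ⟨τ, hτ, rfl⟩ := hu
  have hs : 0 ≤ ∑ i, normCoeff a θ T' i := Finset.sum_nonneg fun i _ => hd0 i
  refine norm_le_of_forall_abs_le (by positivity) fun i => ?_
  have h1 : normCoeff a θ T i ≤ ∑ i, normCoeff a θ T' i :=
    (normCoeff_mono hT hTT' i (hint i)).trans
      (Finset.single_le_sum (fun i _ => hd0 i) (Finset.mem_univ i))
  have h2 : |(τ - θ) i| ≤ |C| + ‖θ‖ := by
    rw [← Real.norm_eq_abs]
    refine (PiLp.norm_apply_le _ i).trans ((norm_sub_le _ _).trans ?_)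
    have := hC τ hτ
    have := le_abs_self C
    linarith
  simp only [diagMul]
  rw [abs_mul, abs_of_nonneg (show 0 ≤ normCoeff a θ T i from Real.sqrt_nonneg _)]
  exact mul_le_mul h1 h2 (abs_nonneg _) hs

theorem continuousOn_increment (hθ : θ ∈ Θ)
    (ha : ContinuousOn (Function.uncurry a) (Ici 0 ×ˢ closure Θ))
    (hd : ∀ i, 0 < normCoeff a θ T i) {u : EuclideanSpace ℝ (Fin q)}
    (hu : u ∈ localSet a Θ θ T) : ContinuousOn (fun t => increment a θ T t u) (Icc 0 T) := by
  have hc : ∀ τ ∈ closure Θ, ContinuousOn (fun t => a t τ) (Icc 0 T) := fun τ hτ =>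
    ha.comp (f := fun t : ℝ => (t, τ)) (by fun_prop) fun t ht => ⟨ht.1, hτ⟩
  exact (hc _ (mem_closure_of_mem_localSet hd hu)).sub (hc _ (subset_closure hθ))

/-- Pointwise, the right side minus the left is the square `(s x + (x - y))² / s`. The factor `1 +
s` can be taken close to 1, which is what keeps the passage to a net point within the slack `δ <
1/2`. -/
theorem distFun_comparison (hT : 0 ≤ T) (hinc : ∀ u ∈ localSet a Θ θ T,
      ContinuousOn (fun t => increment a θ T t u) (Icc 0 T))
    {u v : EuclideanSpace ℝ (Fin q)} (hu : u ∈ localSet a Θ θ T) (hv : v ∈ localSet a Θ θ T)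
    {s : ℝ} (hs : 0 < s) :
    distFun a θ T v 0 ≤ (1 + s) * distFun a θ T u 0 + (1 + 1 / s) * distFun a θ T u v := by
  have hI : uIcc 0 T = Icc 0 T := uIcc_of_le hT
  have i1 : IntervalIntegrable (fun t => increment a θ T t u ^ 2) volume 0 T :=
    ContinuousOn.intervalIntegrable (by rw [hI]; exact (hinc u hu).pow 2)
  have i2 : IntervalIntegrable (fun t => increment a θ T t v ^ 2) volume 0 T :=
    ContinuousOn.intervalIntegrable (by rw [hI]; exact (hinc v hv).pow 2)
  have i3 : IntervalIntegrable (fun t => (increment a θ T t u - increment a θ T t v) ^ 2)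
      volume 0 T :=
    ContinuousOn.intervalIntegrable (by rw [hI]; exact ((hinc u hu).sub (hinc v hv)).pow 2)
  simp only [distFun, increment_zero, sub_zero]
  rw [← intervalIntegral.integral_const_mul, ← intervalIntegral.integral_const_mul,
    ← intervalIntegral.integral_add (i1.const_mul _) (i3.const_mul _)]
  refine intervalIntegral.integral_mono_on hT i2 ((i1.const_mul _).add (i3.const_mul _))
    fun t _ => ?_
  set x := increment a θ T t u
  set y := increment a θ T t v
  have h : 0 ≤ (s * x + (x - y)) ^ 2 / s := by positivity
  have e : (1 + s) * x ^ 2 + (1 + 1 / s) * (x - y) ^ 2 - y ^ 2 = (s * x + (x - y)) ^ 2 / s := by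
    field_simp
    ring
  linarith

/-- At a minimizer of the least squares functional the linear functional of the noise dominates
half of the squared distance. -/
theorem half_distFun_le_of_isMinOn (hT : 0 ≤ T) (hθ : θ ∈ Θ) (hd : ∀ i, 0 < normCoeff a θ T i)
    (hinc : ∀ u ∈ localSet a Θ θ T, ContinuousOn (fun t => increment a θ T t u) (Icc 0 T))
    {x : ℝ → ℝ} (hx : Continuous x) {τ : EuclideanSpace ℝ (Fin q)} (hτ : τ ∈ closure Θ)
    (hmin : IsMinOn (leastSquares a T (fun t => a t θ + x t)) (closure Θ) τ) :
    1 / 2 * distFun a θ T (diagMul (normCoeff a θ T) (τ - θ)) 0 ≤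
      ∫ t in (0 : ℝ)..T, x t * increment a θ T t (diagMul (normCoeff a θ T) (τ - θ)) := by
  set u := diagMul (normCoeff a θ T) (τ - θ) with hu
  have huU : u ∈ localSet a Θ θ T := ⟨τ, hτ, rfl⟩
  have hI : uIcc 0 T = Icc 0 T := uIcc_of_le hT
  have h := isMinOn_iff.1 hmin θ (subset_closure hθ)
  have hΔ : ∀ t, increment a θ T t u = a t τ - a t θ := fun t => by
    rw [increment, hu, diagMul_inv_diagMul hd, add_sub_cancel]
  have i1 : IntervalIntegrable (fun t => x t ^ 2) volume 0 T := (hx.pow 2).intervalIntegrable _ _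
  have i2 : IntervalIntegrable (fun t => x t * increment a θ T t u) volume 0 T :=
    ContinuousOn.intervalIntegrable (by rw [hI]; exact hx.continuousOn.mul (hinc u huU))
  have i3 : IntervalIntegrable (fun t => increment a θ T t u ^ 2) volume 0 T :=
    ContinuousOn.intervalIntegrable (by rw [hI]; exact (hinc u huU).pow 2)
  have e1 : leastSquares a T (fun t => a t θ + x t) τ =
      (∫ t in (0 : ℝ)..T, x t ^ 2) - 2 * (∫ t in (0 : ℝ)..T, x t * increment a θ T t u) +
        ∫ t in (0 : ℝ)..T, increment a θ T t u ^ 2 := by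
    rw [leastSquares, ← intervalIntegral.integral_const_mul,
      ← intervalIntegral.integral_sub i1 (i2.const_mul _),
      ← intervalIntegral.integral_add (i1.sub (i2.const_mul _)) i3]
    congr 1 with t
    rw [hΔ]
    ring
  have e2 : leastSquares a T (fun t => a t θ + x t) θ = ∫ t in (0 : ℝ)..T, x t ^ 2 := by
    rw [leastSquares]
    congr 1 with t
    ring
  rw [e1, e2] at h
  simp only [distFun, increment_zero, sub_zero]
  linarith

end Model

/-! ### Tails and continuity of the noise functional. -/

section NoiseFunctional

variable {Ω : Type*} {ε : ℝ → Ω → ℝ} {q : ℕ}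
  {a : ℝ → EuclideanSpace ℝ (Fin q) → ℝ} {θ : EuclideanSpace ℝ (Fin q)} {T : ℝ}
  {S : Set (EuclideanSpace ℝ (Fin q))}

/-- The linear functional `u ↦ ∫₀ᵀ ε(t) Δ(t, u) dt` of the noise. -/
noncomputable def noiseFunctional (ε : ℝ → Ω → ℝ) (a : ℝ → EuclideanSpace ℝ (Fin q) → ℝ)
    (θ : EuclideanSpace ℝ (Fin q)) (T : ℝ) (u : EuclideanSpace ℝ (Fin q)) (ω : Ω) : ℝ :=
  ∫ t in (0 : ℝ)..T, ε t ω * increment a θ T t u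

theorem noiseFunctional_zero (ω : Ω) : noiseFunctional ε a θ T 0 ω = 0 := by
  simp [noiseFunctional, increment_zero]

theorem noiseFunctional_sub (hT : 0 ≤ T) {u v : EuclideanSpace ℝ (Fin q)}
    (hu : ContinuousOn (fun t => increment a θ T t u) (Icc 0 T))
    (hv : ContinuousOn (fun t => increment a θ T t v) (Icc 0 T))
    {ω : Ω} (hω : Continuous fun t => ε t ω) :
    noiseFunctional ε a θ T u ω - noiseFunctional ε a θ T v ω =
      ∫ t in (0 : ℝ)..T, ε t ω * (increment a θ T t u - increment a θ T t v) := by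
  have hI : uIcc 0 T = Icc 0 T := uIcc_of_le hT
  rw [noiseFunctional, noiseFunctional, ← intervalIntegral.integral_sub]
  · congr 1 with t
    ring
  · exact ContinuousOn.intervalIntegrable (by rw [hI]; exact hω.continuousOn.mul hu)
  · exact ContinuousOn.intervalIntegrable (by rw [hI]; exact hω.continuousOn.mul hv)

variable [MeasurableSpace Ω] {P : Measure Ω}

theorem measure_le_noiseFunctional_sub_le (hN1 : IsCenteredContinuousProcess P ε)
    (hN2 : IsJointlyStrictlySubGaussian P ε) (hstat : IsStationaryCov P ε) {f : ℝ → ℝ}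
    (hs : IsSpectralDensity P ε f) {f₀ : ℝ} (hf : ∀ l, f l ≤ f₀) (hT : 0 < T)
    {u v : EuclideanSpace ℝ (Fin q)}
    (hu : ContinuousOn (fun t => increment a θ T t u) (Icc 0 T))
    (hv : ContinuousOn (fun t => increment a θ T t v) (Icc 0 T))
    {V : ℝ} (hV0 : 0 ≤ V) (hV : 2 * Real.pi * f₀ * distFun a θ T u v ≤ V) {x : ℝ} (hx : 0 ≤ x) :
    P.real {ω | x ≤ noiseFunctional ε a θ T u ω - noiseFunctional ε a θ T v ω} ≤
      Real.exp (-x ^ 2 / (2 * V)) := by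
  have h := hasSubgaussianMGF_integral hN1 hN2 hstat hs hf hT (V := ⟨V, hV0⟩) (hu.sub hv) hV
  refine (h.congr ?_).measure_ge_le hx
  filter_upwards [hN1.ae_continuous] with ω hω
  exact (noiseFunctional_sub hT.le hu hv hω).symm

/-- Path by path, `|b(u) - b(v)|² ≤ (∫ ε²) Φ(u,v)` by Cauchy–Schwarz. Chaining needs this to reach
`u` as a limit of net points. -/
theorem ae_continuousOn_noiseFunctional (hN1 : IsCenteredContinuousProcess P ε) (hT : 0 ≤ T)
    (hinc : ∀ u ∈ S, ContinuousOn (fun t => increment a θ T t u) (Icc 0 T))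
    {κ p ρ : ℝ} (hκ : 0 < κ) (hρ : 0 < ρ)
    (hΦ : ∀ u ∈ S, ∀ v ∈ S, ‖u - v‖ ≤ κ → distFun a θ T u v ≤ p * ‖u - v‖ ^ (2 * ρ)) :
    ∀ᵐ ω ∂P, ContinuousOn (fun u => noiseFunctional ε a θ T u ω) S := by
  filter_upwards [hN1.ae_continuous] with ω hω v hv
  rw [ContinuousWithinAt, tendsto_iff_norm_sub_tendsto_zero]
  set c := ∫ t in (0 : ℝ)..T, ε t ω ^ 2
  have hc : 0 ≤ c := intervalIntegral.integral_nonneg hT fun t _ => sq_nonneg _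
  have hbound : ∀ᶠ u in 𝓝[S] v, ‖noiseFunctional ε a θ T u ω - noiseFunctional ε a θ T v ω‖ ≤
      √(c * (p * ‖u - v‖ ^ (2 * ρ))) := by
    have hnear : ∀ᶠ u in 𝓝[S] v, ‖u - v‖ < κ := by
      refine eventually_nhdsWithin_of_eventually_nhds ?_
      filter_upwards [Metric.ball_mem_nhds v hκ] with u hu
      rwa [Metric.mem_ball, dist_eq_norm] at hu
    filter_upwards [hnear, self_mem_nhdsWithin] with u huκ hu
    rw [noiseFunctional_sub hT (hinc u hu) (hinc v hv) hω, Real.norm_eq_abs]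
    refine Real.abs_le_sqrt ?_
    exact (sq_intervalIntegral_mul_le hT hω.continuousOn ((hinc u hu).sub (hinc v hv))).trans
      (mul_le_mul_of_nonneg_left (hΦ u hu v hv huκ.le) hc)
  refine squeeze_zero' (Eventually.of_forall fun u => norm_nonneg _) hbound ?_
  have hcont : Continuous fun u : EuclideanSpace ℝ (Fin q) =>
      √(c * (p * ‖u - v‖ ^ (2 * ρ))) := by
    refine Real.continuous_sqrt.comp (continuous_const.mul (continuous_const.mul ?_))
    exact (continuous_id.sub continuous_const).norm.rpow_const fun _ => Or.inr (by positivity)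
  have := (hcont.tendsto v).mono_left (nhdsWithin_le_nhds (s := S))
  simpa [Real.zero_rpow (by positivity : 2 * ρ ≠ 0)] using this

end NoiseFunctional

/-! ### Maximal inequality on one shell. -/

section ShellBound

variable {Ω : Type*} [MeasurableSpace Ω] {P : Measure Ω} [IsProbabilityMeasure P]
  {ε : ℝ → Ω → ℝ} {q : ℕ} {Θ : Set (EuclideanSpace ℝ (Fin q))}
  {a : ℝ → EuclideanSpace ℝ (Fin q) → ℝ} {θ : EuclideanSpace ℝ (Fin q)} {T : ℝ}
  {S : Set (EuclideanSpace ℝ (Fin q))}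

/-- The maximal inequality on a bounded set on which the squared distance to the origin is at
least `2 d₀ δ⁻² g` and has Hölder modulus with constant `p`. -/
theorem measure_exists_half_distFun_le (hN1 : IsCenteredContinuousProcess P ε)
    (hN2 : IsJointlyStrictlySubGaussian P ε) (hstat : IsStationaryCov P ε) {f : ℝ → ℝ}
    (hs : IsSpectralDensity P ε f) {f₀ : ℝ} (hf : ∀ l, f l ≤ f₀) {d₀ : ℝ}
    (hd₀ : d₀ = 2 * Real.pi * f₀) (hd₀pos : 0 < d₀) (hT : 0 < T)
    (hinc : ∀ u ∈ localSet a Θ θ T, ContinuousOn (fun t => increment a θ T t u) (Icc 0 T))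
    (h0 : (0 : EuclideanSpace ℝ (Fin q)) ∈ localSet a Θ θ T)
    (hSU : S ⊆ localSet a Θ θ T) {M : ℝ} (hM : 1 ≤ M) (hS : ∀ x ∈ S, ‖x‖ ≤ M)
    {κ ρ p W g δ s : ℝ} (hρ : 0 < ρ) {J : ℕ} (hJ : 1 ≤ J) (hJρ : 1 ≤ J * ρ)
    (hp : 1 ≤ p) (hW : 1 ≤ W) (hWκ : 1 ≤ W * κ) (hg : 0 < g) (hWg : 8 * d₀ * (g + 1) ≤ W ^ 2 * p)
    (hδ : 0 < δ) (hs0 : 0 < s)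
    (hgs : 1 + 1 / s + 2 * (1 + s) ≤ (1 - 2 * δ * (1 + s)) * (2 * d₀ * (δ ^ 2)⁻¹ * g))
    (hsδ : 2 * δ * (1 + s) < 1)
    (hΦ : ∀ u ∈ S, ∀ v ∈ S, ‖u - v‖ ≤ κ → distFun a θ T u v ≤ p * ‖u - v‖ ^ (2 * ρ))
    (hlow : ∀ u ∈ S, 2 * d₀ * (δ ^ 2)⁻¹ * g ≤ distFun a θ T u 0) :
    P.real {ω | ∃ u ∈ S, 1 / 2 * distFun a θ T u 0 ≤ noiseFunctional ε a θ T u ω} ≤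
      ((2 * (2 * q + 4) * M * (W * p) ^ J) ^ q + (2 * (2 * q + 4) * M * (W * p) ^ J) ^ (2 * q) *
        (∑' k : ℕ, ((4 : ℝ) ^ (k + 1)) ^ (J * (2 * q)) * Real.exp (-(4 : ℝ) ^ k))) *
          Real.exp (-g) := by
  have hW0 : 0 < W := by linarith
  have hp0 : 0 < p := by linarith
  have hκ0 : 0 < κ := by
    by_contra! h
    nlinarith
  -- This one choice gives `η ≤ κ`, `p η² ≤ 1` and the chaining condition `8 d₀ p η² (g + 1) ≤ 1`.
  set η := 1 / (W * p) with hη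
  have hη0 : 0 < η := by positivity
  have hWp : 1 ≤ W * p := one_le_mul_of_one_le_of_one_le hW hp
  have hη1 : η ≤ 1 := (div_le_one (by positivity)).2 hWp
  have hηκ : η ≤ κ := by
    rw [hη, div_le_iff₀ (by positivity)]
    nlinarith
  have hηp : p * η ^ 2 ≤ 1 := by
    rw [hη, div_pow, one_pow, mul_one_div, div_le_one (by positivity)]
    nlinarith
  have htail : ∀ u ∈ S, ∀ v ∈ S, ∀ y, 0 < y → ‖u - v‖ ≤ κ → ‖u - v‖ ^ ρ ≤ y → ∀ x, 0 ≤ x →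
      P.real {ω | x ≤ noiseFunctional ε a θ T u ω - noiseFunctional ε a θ T v ω} ≤
        Real.exp (-x ^ 2 / (2 * (d₀ * p * y ^ 2))) := by
    intro u hu v hv y hy hκuv hρuv x hx
    refine measure_le_noiseFunctional_sub_le hN1 hN2 hstat hs hf hT (hinc u (hSU hu))
      (hinc v (hSU hv)) (by positivity) ?_ hx
    rw [← hd₀, mul_assoc]
    refine mul_le_mul_of_nonneg_left ((hΦ u hu v hv hκuv).trans ?_) hd₀pos.le
    refine mul_le_mul_of_nonneg_left ?_ hp0.le
    rw [mul_comm, Real.rpow_mul (norm_nonneg _), Real.rpow_two]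
    exact pow_le_pow_left₀ (by positivity) hρuv 2
  obtain ⟨π, hπ, hfin, hcard, hosc⟩ := exists_net_measure_oscillation_le (P := P) (S := S) hM hS
    (b := noiseFunctional ε a θ T) hρ.le hJ hJρ (mul_pos hd₀pos hp0) htail
    (ae_continuousOn_noiseFunctional hN1 hT.le (fun u hu => hinc u (hSU hu)) hκ0 hρ hΦ)
    hη0 hη1 hηκ hg.le (by
      rw [hη, div_pow, one_pow]
      field_simp
      nlinarith)
  have hNeq : 2 * (2 * q + 4) * M / η ^ J = 2 * (2 * q + 4) * M * (W * p) ^ J := by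
    rw [hη, one_div, inv_pow, div_inv_eq_mul]
  rw [hNeq] at hcard hosc
  set N := 2 * (2 * q + 4) * M * (W * p) ^ J
  set Z := ∑' k : ℕ, ((4 : ℝ) ^ (k + 1)) ^ (J * (2 * q)) * Real.exp (-(4 : ℝ) ^ k)
  -- The variance proxy is `d₀ Φ`, so the exponent is `δ² Φ / (2 d₀)`, at least `g` by the lower
  -- bound on `Φ`.
  have hpoint : ∀ v ∈ hfin.toFinset,
      P.real {ω | δ * distFun a θ T v 0 ≤ noiseFunctional ε a θ T v ω} ≤ Real.exp (-g) := by
    intro v hv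
    rw [Finite.mem_toFinset] at hv
    obtain ⟨w, hw, rfl⟩ := hv
    have hvS := (hπ w hw).1
    have hΦv := hlow _ hvS
    have hlb : 0 < 2 * d₀ * (δ ^ 2)⁻¹ * g := by positivity
    set Φ := distFun a θ T (π w) 0
    have hΦ0 : 0 < Φ := hlb.trans_le hΦv
    have h := measure_le_noiseFunctional_sub_le hN1 hN2 hstat hs hf hT (hinc _ (hSU hvS))
      (hinc 0 h0) (V := d₀ * Φ) (by positivity) (by rw [← hd₀]) (x := δ * Φ) (by positivity)
    simp only [noiseFunctional_zero, sub_zero] at h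
    refine h.trans (Real.exp_le_exp.2 ?_)
    have e : -(δ * Φ) ^ 2 / (2 * (d₀ * Φ)) = -(δ ^ 2 * Φ / (2 * d₀)) := by
      field_simp
    rw [e, neg_le_neg_iff, le_div_iff₀ (by positivity)]
    calc g * (2 * d₀) = δ ^ 2 * (2 * d₀ * (δ ^ 2)⁻¹ * g) := by field_simp
      _ ≤ δ ^ 2 * Φ := by gcongr
  -- If the oscillation is at most 1, then `b(π u) ≥ ½ Φ(u,0) - 1`, and `hgs` with the comparison of
  -- `Φ` at `u` and `π u` makes this at least `δ Φ(π u,0)`.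
  have hsub : {ω | ∃ u ∈ S, 1 / 2 * distFun a θ T u 0 ≤ noiseFunctional ε a θ T u ω} ⊆
      (⋃ v ∈ hfin.toFinset, {ω | δ * distFun a θ T v 0 ≤ noiseFunctional ε a θ T v ω}) ∪
      {ω | ∃ u ∈ S, 1 < noiseFunctional ε a θ T u ω - noiseFunctional ε a θ T (π u) ω} := by
    rintro ω ⟨u, hu, hω⟩
    by_cases h1 : 1 < noiseFunctional ε a θ T u ω - noiseFunctional ε a θ T (π u) ω
    · exact Or.inr ⟨u, hu, h1⟩
    left
    simp only [mem_iUnion]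
    refine ⟨π u, by rw [Finite.mem_toFinset]; exact ⟨u, hu, rfl⟩, ?_⟩
    simp only [mem_ofPred_eq]
    obtain ⟨hv, hd⟩ := hπ u hu
    have hdη : ‖u - π u‖ ≤ η := hd.trans (pow_le_of_le_one hη0.le hη1 (by omega))
    have hΦuv : distFun a θ T u (π u) ≤ 1 := by
      refine (hΦ u hu _ hv (hdη.trans hηκ)).trans (le_trans ?_ hηp)
      refine mul_le_mul_of_nonneg_left ?_ hp0.le
      rw [mul_comm, Real.rpow_mul (norm_nonneg _), Real.rpow_two]
      refine pow_le_pow_left₀ (by positivity) ((Real.rpow_le_rpow (norm_nonneg _) hd hρ.le).trans ?_) 2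
      rw [← Real.rpow_natCast, ← Real.rpow_mul hη0.le]
      exact Real.rpow_le_self_of_le_one hη0.le hη1 hJρ
    have hcmp := distFun_comparison hT.le hinc (hSU hu) (hSU hv) hs0
    have hΦv := hlow _ hv
    set Φu := distFun a θ T u 0
    set Φv := distFun a θ T (π u) 0
    have h2 : 1 + 1 / s + 2 * (1 + s) ≤ (1 - 2 * δ * (1 + s)) * Φv :=
      hgs.trans (mul_le_mul_of_nonneg_left hΦv (by linarith))
    have h3 : (1 + 1 / s) * distFun a θ T u (π u) ≤ 1 + 1 / s :=
      mul_le_of_le_one_right (by positivity) hΦuv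
    have h4 : (1 + s) * (2 * (δ * Φv) + 2) ≤ (1 + s) * Φu := by nlinarith
    have h5 := le_of_mul_le_mul_left h4 (by positivity)
    linarith
  have hU : P.real (⋃ v ∈ hfin.toFinset,
      {ω | δ * distFun a θ T v 0 ≤ noiseFunctional ε a θ T v ω}) ≤ N ^ q * Real.exp (-g) :=
    calc _ ≤ ∑ v ∈ hfin.toFinset,
          P.real {ω | δ * distFun a θ T v 0 ≤ noiseFunctional ε a θ T v ω} :=
          measureReal_biUnion_finset_le _ _
      _ ≤ ∑ _v ∈ hfin.toFinset, Real.exp (-g) := Finset.sum_le_sum hpoint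
      _ = (π '' S).ncard * Real.exp (-g) := by
          rw [Finset.sum_const, nsmul_eq_mul, ncard_eq_toFinset_card _ hfin]
      _ ≤ _ := by gcongr
  calc _ ≤ _ := measureReal_mono hsub
    _ ≤ _ := measureReal_union_le _ _
    _ ≤ N ^ q * Real.exp (-g) + N ^ (2 * q) * Z * Real.exp (-g) := add_le_add hU hosc
    _ = _ := by ring

end ShellBound

/-! ### Polynomial growth and summation over shells. -/

theorem Polynomial.eval_le_sum_abs_coeff_mul_pow (γ : Polynomial ℝ) {n : ℕ} (hn : γ.natDegree ≤ n)
    {x : ℝ} (hx : 1 ≤ x) :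
    γ.eval x ≤ (∑ i ∈ Finset.range (γ.natDegree + 1), |γ.coeff i|) * x ^ n := by
  rw [Polynomial.eval_eq_sum_range, Finset.sum_mul]
  refine Finset.sum_le_sum fun i hi => ?_
  have hi' : i ≤ n := (Nat.lt_succ_iff.1 (Finset.mem_range.1 hi)).trans hn
  calc γ.coeff i * x ^ i ≤ |γ.coeff i| * x ^ i := by gcongr; exact le_abs_self _
    _ ≤ |γ.coeff i| * x ^ n := by gcongr

theorem Polynomial.exists_eval_le_mul_pow (γ₁ γ₂ : Polynomial ℝ) :
    ∃ C : ℝ, 1 ≤ C ∧ ∃ n : ℕ, ∀ x : ℝ, 1 ≤ x → γ₁.eval x ≤ C * x ^ n ∧ γ₂.eval x ≤ C * x ^ n := by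
  set c₁ := ∑ i ∈ Finset.range (γ₁.natDegree + 1), |γ₁.coeff i|
  set c₂ := ∑ i ∈ Finset.range (γ₂.natDegree + 1), |γ₂.coeff i|
  have h₁ : 0 ≤ c₁ := Finset.sum_nonneg fun i _ => abs_nonneg _
  have h₂ : 0 ≤ c₂ := Finset.sum_nonneg fun i _ => abs_nonneg _
  refine ⟨1 + c₁ + c₂, by linarith, max γ₁.natDegree γ₂.natDegree, fun x hx => ⟨?_, ?_⟩⟩
  · refine (γ₁.eval_le_sum_abs_coeff_mul_pow (le_max_left _ γ₂.natDegree) hx).trans ?_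
    gcongr
    linarith
  · refine (γ₂.eval_le_sum_abs_coeff_mul_pow (le_max_right γ₁.natDegree _) hx).trans ?_
    gcongr
    linarith

/-- A rate function that beats all powers absorbs a polynomial factor at the shells `R + k`. -/
theorem mul_pow_mul_exp_neg_le {G : ℝ → ℝ} (hG : MonotoneOn G (Ioi 0)) {C R b : ℝ} {m : ℕ}
    (hC : 0 ≤ C) (hR : 1 ≤ R) (hb0 : 0 < b) (hb1 : b < 1)
    (hdec : ∀ x, R ≤ x → x ^ (((m + 2 : ℕ) : ℝ) / (1 - b)) * Real.exp (-G x) ≤ 1) (k : ℕ) :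
    C * (R + k) ^ m * Real.exp (-G (R + k)) ≤
      C * Real.exp (-b * G R) * (1 / ((k : ℝ) + 1) ^ 2) := by
  have hk : (0 : ℝ) ≤ k := Nat.cast_nonneg k
  set x := R + k with hx
  have hx1 : (k : ℝ) + 1 ≤ x := by linarith
  have hx0 : 0 < x := by linarith
  have hb : 0 < 1 - b := by linarith
  have h1 := hdec x (by linarith)
  -- Raise `hdec` to the power `1 - b`. The two powers beyond `m` supply the summable factor
  -- `1/(k+1)²`.
  have h2 : x ^ (m + 2) * Real.exp (-((1 - b) * G x)) ≤ 1 := by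
    have := Real.rpow_le_one (by positivity) h1 hb.le
    rw [Real.mul_rpow (by positivity) (Real.exp_pos _).le, ← Real.rpow_mul hx0.le,
      div_mul_cancel₀ _ hb.ne', Real.rpow_natCast, ← Real.exp_mul] at this
    rwa [show -((1 - b) * G x) = -G x * (1 - b) by ring]
  have h3 : x ^ m * Real.exp (-((1 - b) * G x)) ≤ 1 / ((k : ℝ) + 1) ^ 2 := by
    rw [le_div_iff₀ (by positivity)]
    calc _ ≤ x ^ m * Real.exp (-((1 - b) * G x)) * x ^ 2 := by gcongr
      _ = x ^ (m + 2) * Real.exp (-((1 - b) * G x)) := by ring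
      _ ≤ 1 := h2
  have h4 : G R ≤ G x := hG (mem_Ioi.2 (by linarith)) (mem_Ioi.2 hx0) (by linarith)
  have h5 : Real.exp (-b * G x) ≤ Real.exp (-b * G R) := Real.exp_le_exp.2 (by nlinarith)
  have e : Real.exp (-G x) = Real.exp (-b * G x) * Real.exp (-((1 - b) * G x)) := by
    rw [← Real.exp_add]; ring_nf
  calc C * x ^ m * Real.exp (-G x)
      = C * Real.exp (-b * G x) * (x ^ m * Real.exp (-((1 - b) * G x))) := by rw [e]; ring
    _ ≤ C * Real.exp (-b * G R) * (1 / ((k : ℝ) + 1) ^ 2) := by gcongr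

theorem summable_one_div_add_one_sq : Summable fun k : ℕ => 1 / ((k : ℝ) + 1) ^ 2 := by
  have h := (summable_nat_add_iff 1).2 (Real.summable_one_div_nat_pow.2 (by norm_num : 1 < 2))
  simpa using h

theorem measureReal_le_tsum_of_subset_iUnion {Ω : Type*} [MeasurableSpace Ω] {P : Measure Ω}
    [IsFiniteMeasure P] {A N : Set Ω} {B : ℕ → Set Ω} (hN : P N = 0) (hA : A ⊆ N ∪ ⋃ k, B k)
    {c : ℕ → ℝ} (hB : ∀ k, P.real (B k) ≤ c k) (hc : Summable c) : P.real A ≤ ∑' k, c k := by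
  have hc0 : ∀ k, 0 ≤ c k := fun k => measureReal_nonneg.trans (hB k)
  refine ENNReal.toReal_le_of_le_ofReal (tsum_nonneg hc0) ?_
  rw [ENNReal.ofReal_tsum_of_nonneg hc0 hc]
  calc P A ≤ P N + P (⋃ k, B k) := (measure_mono hA).trans (measure_union_le _ _)
    _ = P (⋃ k, B k) := by rw [hN, zero_add]
    _ ≤ ∑' k, P (B k) := measure_iUnion_le _
    _ ≤ ∑' k, ENNReal.ofReal (c k) := ENNReal.tsum_le_tsum fun k => by
        rw [← ENNReal.ofReal_toReal (measure_ne_top P (B k))]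
        exact ENNReal.ofReal_le_ofReal (hB k)

section

variable {Ω : Type*} [MeasurableSpace Ω] {P : Measure Ω} {q : ℕ}
  {Θ : Set (EuclideanSpace ℝ (Fin q))} {θ : EuclideanSpace ℝ (Fin q)}
  {a : ℝ → EuclideanSpace ℝ (Fin q) → ℝ} {ε : ℝ → Ω → ℝ} {T : ℝ}

/-- Up to a null set, a large deviation of a least squares estimator forces the noise functional
to be large on one of the shells of radius `R + k`. -/
theorem exists_null_deviation_subset_iUnion (hN1 : IsCenteredContinuousProcess P ε) (hT : 0 ≤ T)
    (hθ : θ ∈ Θ) (hd : ∀ i, 0 < normCoeff a θ T i)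
    (hinc : ∀ u ∈ localSet a Θ θ T, ContinuousOn (fun t => increment a θ T t u) (Icc 0 T))
    {est : Ω → EuclideanSpace ℝ (Fin q)} (hest : IsLSE P a Θ θ ε T est) (R : ℝ) :
    ∃ N, P N = 0 ∧ {ω | R ≤ ‖diagMul (normCoeff a θ T) (est ω - θ)‖} ⊆ N ∪ ⋃ k : ℕ,
      {ω | ∃ u ∈ shell a Θ θ T (R + k),
        1 / 2 * distFun a θ T u 0 ≤ noiseFunctional ε a θ T u ω} := by
  refine ⟨_, ae_iff.1 (hN1.ae_continuous.and hest.isMinOn), fun ω hω => ?_⟩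
  by_cases hgood : (Continuous fun t => ε t ω) ∧
      IsMinOn (leastSquares a T (fun t => a t θ + ε t ω)) (closure Θ) (est ω)
  · right
    simp only [mem_ofPred_eq] at hω
    set u := diagMul (normCoeff a θ T) (est ω - θ)
    -- Shells have width 1, so the integer part of `‖u‖ - R` selects the right one.
    refine mem_iUnion.2 ⟨⌊‖u‖ - R⌋₊, u, ⟨⟨est ω, hest.mem_closure ω, rfl⟩, ?_⟩,
      half_distFun_le_of_isMinOn hT hθ hd hinc hgood.1 (hest.mem_closure ω) hgood.2⟩
    have h1 := Nat.floor_le (sub_nonneg.2 hω)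
    have h2 := Nat.lt_floor_add_one (‖u‖ - R)
    exact ⟨by linarith, by linarith⟩
  · exact Or.inl hgood

end

/-- Conditions (R1) and (R2) bound the probability that the noise functional is large on a shell
by a polynomial times `exp (-g)`, uniformly in `T`. -/
theorem exists_shell_bound
    {Ω : Type*} [MeasurableSpace Ω] {P : Measure Ω} [IsProbabilityMeasure P] {q : ℕ}
    {Θ : Set (EuclideanSpace ℝ (Fin q))} {θ : EuclideanSpace ℝ (Fin q)} (hθ : θ ∈ Θ)
    {a : ℝ → EuclideanSpace ℝ (Fin q) → ℝ}
    {ε : ℝ → Ω → ℝ} (hN1 : IsCenteredContinuousProcess P ε)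
    (hN2i : IsJointlyStrictlySubGaussian P ε) (hN3_stat : IsStationaryCov P ε)
    {f : ℝ → ℝ} (hN3_spec : IsSpectralDensity P ε f) {f₀ : ℝ} (hf : ∀ l, f l ≤ f₀)
    (hf₀_pos : 0 < f₀) {T₀ R₀ : ℝ} (hT₀ : 0 ≤ T₀) {g : ℝ → ℝ → ℝ}
    {δ : ℝ} (hδ : δ ∈ Ioo (0 : ℝ) (1 / 2)) {κ : ℝ} (hκ : 0 < κ)
    {ρ : ℝ} (hρ0 : 0 < ρ) {γ₁ γ₂ : Polynomial ℝ}
    (hinc : ∀ T, T₀ < T → ∀ u ∈ localSet a Θ θ T,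
      ContinuousOn (fun t => increment a θ T t u) (Icc 0 T))
    (hR1i : ∀ T, T₀ < T → ∀ R, R₀ < R →
      ∀ u ∈ shell a Θ θ T R, ∀ v ∈ shell a Θ θ T R, ‖u - v‖ ≤ κ →
        distFun a θ T u v ≤ γ₁.eval R * ‖u - v‖ ^ (2 * ρ))
    (hR2 : ∀ T, T₀ < T → ∀ R, R₀ < R →
      ∀ u ∈ shell a Θ θ T R,
        2 * (2 * Real.pi * f₀) * (δ ^ 2)⁻¹ * g T R ≤ distFun a θ T u 0)
    {c : ℝ} (hc0 : 0 < c) (hg_le : ∀ T, T₀ < T → ∀ R, R₀ < R → (shell a Θ θ T R).Nonempty →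
      g T R ≤ c * γ₂.eval R) :
    ∃ C' : ℝ, 0 ≤ C' ∧ ∃ (m : ℕ) (G₀ : ℝ), ∀ T, T₀ < T → ∀ R, R₀ < R → 1 ≤ R → G₀ ≤ g T R →
      P.real {ω | ∃ u ∈ shell a Θ θ T R,
        1 / 2 * distFun a θ T u 0 ≤ noiseFunctional ε a θ T u ω} ≤
          C' * R ^ m * Real.exp (-g T R) := by
  obtain ⟨hδ0, hδ2⟩ := hδ
  set d₀ := 2 * Real.pi * f₀ with hd₀
  have hd₀pos : 0 < d₀ := by positivity
  set J := ⌈1 / ρ⌉₊ with hJdef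
  have hJρ : 1 ≤ J * ρ := by
    have := Nat.le_ceil (1 / ρ)
    rwa [div_le_iff₀ hρ0] at this
  have hJ : 1 ≤ J := Nat.one_le_iff_ne_zero.2 fun h => by
    rw [h, Nat.cast_zero, zero_mul] at hJρ
    linarith
  obtain ⟨C, hC1, n, hC⟩ := Polynomial.exists_eval_le_mul_pow γ₁ γ₂
  -- The summands secure in turn `1 ≤ W`, `1 ≤ W κ` and `8 d₀ (c + 1) ≤ W²`.
  set W := 1 + 1 / κ + 8 * d₀ * (c + 1) with hW
  have hW1 : 1 ≤ W := by
    have : 0 < 1 / κ := by positivity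
    have : 0 < 8 * d₀ * (c + 1) := by positivity
    linarith
  have hWκ : 1 ≤ W * κ := by
    have : 1 / κ * κ = 1 := by field_simp
    have : 0 < 8 * d₀ * (c + 1) * κ := by positivity
    rw [hW]
    nlinarith
  have hWd : 8 * d₀ * (c + 1) ≤ W ^ 2 := by
    have : 0 < 1 / κ := by positivity
    nlinarith
  -- Places `2δ(1 + s)` at the midpoint `1/2 + δ` of `2δ` and 1; this is where `δ < 1/2` enters.
  -- `G₀` is then the least `g` for which the slack covers the constant `H`.
  set s := (1 - 2 * δ) / (4 * δ) with hs
  have hs0 : 0 < s := div_pos (by linarith) (by linarith)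
  have hsδ : 2 * δ * (1 + s) = 1 / 2 + δ := by
    rw [hs]; field_simp; ring
  set H := 1 + 1 / s + 2 * (1 + s) with hH
  have hH0 : 0 < H := by positivity
  set G₀ := H / ((1 / 2 - δ) * (2 * d₀ * (δ ^ 2)⁻¹)) with hG₀
  have hden : 0 < (1 / 2 - δ) * (2 * d₀ * (δ ^ 2)⁻¹) := mul_pos (by linarith) (by positivity)
  have hG₀pos : 0 < G₀ := by positivity
  set Z := ∑' k : ℕ, ((4 : ℝ) ^ (k + 1)) ^ (J * (2 * q)) * Real.exp (-(4 : ℝ) ^ k)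
  have hZ0 : 0 ≤ Z := tsum_nonneg fun k => by positivity
  set N₁ := 4 * (2 * (q : ℝ) + 4) * (W * C) ^ J with hN₁
  have hN₁0 : 0 ≤ N₁ := by positivity
  set m := (1 + n * J) * (2 * q) with hm
  set C' := (1 + Z) * (1 + N₁) ^ (2 * q) with hC'
  have hC'0 : 0 ≤ C' := by positivity
  refine ⟨C', hC'0, m, G₀, fun T hT R hR hR1 hgR => ?_⟩
  rcases (shell a Θ θ T R).eq_empty_or_nonempty with hemp | hne
  · simp only [hemp, mem_empty_iff_false, false_and, exists_false]
    rw [ofPred_false, measureReal_empty]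
    positivity
  have hRn : 1 ≤ R ^ n := one_le_pow₀ hR1
  have hg0 : 0 < g T R := hG₀pos.trans_le hgR
  have hp1 : 1 ≤ C * R ^ n := one_le_mul_of_one_le_of_one_le hC1 hRn
  have hgp : g T R ≤ c * (C * R ^ n) :=
    (hg_le T hT R hR hne).trans (mul_le_mul_of_nonneg_left (hC R hR1).2 hc0.le)
  have hWg : 8 * d₀ * (g T R + 1) ≤ W ^ 2 * (C * R ^ n) :=
    calc 8 * d₀ * (g T R + 1) ≤ 8 * d₀ * (c + 1) * (C * R ^ n) := by
          rw [mul_assoc (8 * d₀)]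
          refine mul_le_mul_of_nonneg_left ?_ (by positivity)
          linarith
      _ ≤ _ := by gcongr
  have hgs : H ≤ (1 - 2 * δ * (1 + s)) * (2 * d₀ * (δ ^ 2)⁻¹ * g T R) := by
    rw [hG₀, div_le_iff₀ hden] at hgR
    rw [hsδ]
    exact hgR.trans_eq (by ring)
  have hmain := measure_exists_half_distFun_le hN1 hN2i hN3_stat hN3_spec hf hd₀ hd₀pos
    (hT₀.trans_lt hT) (hinc T hT) (zero_mem_localSet hθ) (S := shell a Θ θ T R)
    inter_subset_left (M := R + 1) (by linarith) (fun x hx => hx.2.2) hρ0 hJ hJρ hp1 hW1 hWκ hg0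
    hWg hδ0 hs0 hgs (by rw [hsδ]; linarith)
    (fun u hu v hv huv => (hR1i T hT R hR u hu v hv huv).trans
      (mul_le_mul_of_nonneg_right (hC R hR1).1 (by positivity)))
    (hR2 T hT R hR)
  refine hmain.trans (mul_le_mul_of_nonneg_right ?_ (Real.exp_pos _).le)
  set X := 2 * (2 * (q : ℝ) + 4) * (R + 1) * (W * (C * R ^ n)) ^ J with hX
  have hX1 : X ≤ (1 + N₁) * R ^ (1 + n * J) := by
    calc X ≤ 2 * (2 * (q : ℝ) + 4) * (2 * R) * (W * (C * R ^ n)) ^ J := by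
          rw [hX]; gcongr; linarith
      _ = N₁ * R ^ (1 + n * J) := by
          rw [hN₁, pow_add, pow_mul, ← mul_assoc W, mul_pow (W * C)]; ring
      _ ≤ _ := by gcongr; linarith
  have hX0 : 0 ≤ X := by positivity
  have hY1 : 1 ≤ (1 + N₁) * R ^ (1 + n * J) :=
    one_le_mul_of_one_le_of_one_le (by linarith) (one_le_pow₀ hR1)
  calc X ^ q + X ^ (2 * q) * Z
      ≤ ((1 + N₁) * R ^ (1 + n * J)) ^ (2 * q) +
          ((1 + N₁) * R ^ (1 + n * J)) ^ (2 * q) * Z := by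
        refine add_le_add ?_ (mul_le_mul_of_nonneg_right (pow_le_pow_left₀ hX0 hX1 _) hZ0)
        exact (pow_le_pow_left₀ hX0 hX1 q).trans (pow_le_pow_right₀ hY1 (by omega))
    _ = C' * R ^ m := by rw [hC', hm, pow_mul R, mul_pow]; ring

/-! ### The exponential bound for the estimator. -/

theorem corollary1
    {Ω : Type*} [MeasurableSpace Ω] (P : Measure Ω) [IsProbabilityMeasure P]
    {q : ℕ}
    -- the parameter set, the true parameter and the regression function
    (Θ : Set (EuclideanSpace ℝ (Fin q)))
    (hΘ_open : IsOpen Θ) (hΘ_bdd : Bornology.IsBounded Θ) (hΘ_conv : Convex ℝ Θ)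
    (θ : EuclideanSpace ℝ (Fin q)) (hθ : θ ∈ Θ)
    (a : ℝ → EuclideanSpace ℝ (Fin q) → ℝ)
    (ha_cont : ContinuousOn (Function.uncurry a) (Ici 0 ×ˢ closure Θ))
    (ha_C1 : ∀ t, 0 ≤ t → ContDiffOn ℝ 1 (a t) Θ)
    -- the noise
    (ε : ℝ → Ω → ℝ)
    (hN1 : IsCenteredContinuousProcess P ε)
    (hN2i : IsJointlyStrictlySubGaussian P ε)
    (hN3_stat : IsStationaryCov P ε)
    (f : ℝ → ℝ) (hN3_spec : IsSpectralDensity P ε f)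
    (f₀ : ℝ) (hf₀ : IsLUB (range f) f₀) (hf₀_pos : 0 < f₀)
    -- the constants and functions in the conditions on the regression function
    (T₀ R₀ : ℝ) (hT₀ : 0 ≤ T₀) (hR₀ : 0 ≤ R₀)
    (g : ℝ → ℝ → ℝ) (hg : IsRateFamily g)
    (δ : ℝ) (hδ : δ ∈ Ioo (0 : ℝ) (1 / 2)) (κ : ℝ) (hκ : 0 < κ)
    (ρ : ℝ) (hρ : ρ ∈ Ioc (0 : ℝ) 1) (γ₁ γ₂ : Polynomial ℝ)
    -- the normalizing matrix is well defined and invertible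
    (hd_int : ∀ T, T₀ < T → ∀ i : Fin q,
      IntervalIntegrable (fun t => (partialDeriv a θ i t) ^ 2) volume 0 T)
    (hd_pos : ∀ T, T₀ < T → ∀ i : Fin q, 0 < normCoeff a θ T i)
    (hR1i : ∀ T, T₀ < T → ∀ R, R₀ < R →
      ∀ u ∈ shell a Θ θ T R, ∀ v ∈ shell a Θ θ T R, ‖u - v‖ ≤ κ →
        distFun a θ T u v ≤ γ₁.eval R * ‖u - v‖ ^ (2 * ρ))
    (hR1ii : ∀ T, T₀ < T → ∀ R, R₀ < R →
      ∀ u ∈ shell a Θ θ T R, distFun a θ T u 0 ≤ γ₂.eval R)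
    (hR2 : ∀ T, T₀ < T → ∀ R, R₀ < R →
      ∀ u ∈ shell a Θ θ T R,
        2 * (2 * Real.pi * f₀) * (δ ^ 2)⁻¹ * g T R ≤ distFun a θ T u 0) :
    ∀ β : ℝ, 0 < β → ∃ B₀ b₀ : ℝ, 0 < B₀ ∧ 0 < b₀ ∧ ρ / (ρ + q) - β ≤ b₀ ∧
      ∀ T, T₀ < T → ∀ R, R₀ < R →
        ∀ est : Ω → EuclideanSpace ℝ (Fin q), IsLSE P a Θ θ ε T est →
          P.real {ω | R ≤ ‖diagMul (normCoeff a θ T) (est ω - θ)‖}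
            ≤ B₀ * Real.exp (-b₀ * g T R) := by
  intro β hβ
  obtain ⟨hρ0, hρ1⟩ := hρ
  have hδ0 := hδ.1
  have hf : ∀ l, f l ≤ f₀ := fun l => hf₀.1 ⟨l, rfl⟩
  have hinc : ∀ T, T₀ < T → ∀ u ∈ localSet a Θ θ T,
      ContinuousOn (fun t => increment a θ T t u) (Icc 0 T) := fun T hT u hu =>
    continuousOn_increment hθ ha_cont (hd_pos T hT) hu
  obtain ⟨c, hc0, hg_le⟩ : ∃ c : ℝ, 0 < c ∧ ∀ T, T₀ < T → ∀ R, R₀ < R →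
      (shell a Θ θ T R).Nonempty → g T R ≤ c * γ₂.eval R := by
    -- At any point of the shell (R2) and (R1)(ii) bound the same `Φ(u,0)` from both sides.
    refine ⟨δ ^ 2 / (2 * (2 * Real.pi * f₀)), by positivity, ?_⟩
    rintro T hT R hR ⟨u, hu⟩
    have h := (hR2 T hT R hR u hu).trans (hR1ii T hT R hR u hu)
    calc g T R = δ ^ 2 / (2 * (2 * Real.pi * f₀)) *
          (2 * (2 * Real.pi * f₀) * (δ ^ 2)⁻¹ * g T R) := by field_simp
      _ ≤ _ := by gcongr
  obtain ⟨C', hC'0, m, G₀, hshell⟩ := exists_shell_bound hθ hN1 hN2i hN3_stat hN3_spec hf hf₀_pos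
    hT₀ hδ hκ hρ0 hinc hR1i hR2 hc0 hg_le
  -- Any value below 1 and at least `1 - β` would do; `1/2` keeps it positive when `β` is large.
  set b₀ := max (1 / 2) (1 - β) with hb₀
  have hb0 : 0 < b₀ := lt_max_of_lt_left (by norm_num)
  have hb1 : b₀ < 1 := max_lt (by norm_num) (by linarith)
  have hb : ρ / (ρ + q) - β ≤ b₀ := by
    have hq : (0 : ℝ) ≤ q := Nat.cast_nonneg q
    have : ρ / (ρ + q) ≤ 1 := div_le_one_of_le₀ (by linarith) (by linarith)
    exact le_trans (by linarith) (le_max_right _ _)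
  set r : ℝ := ((m + 2 : ℕ) : ℝ) / (1 - b₀) with hr
  have hr0 : 0 < r := div_pos (by positivity) (by linarith)
  obtain ⟨T₁, R₁, hdec⟩ : ∃ T₁ R₁ : ℝ, ∀ T, T₁ ≤ T → ∀ R, R₁ ≤ R →
      R ^ r * Real.exp (-g T R) ≤ 1 := by
    have h := (hg.decay r hr0).eventually (ge_mem_nhds zero_lt_one)
    rw [prod_atTop_atTop_eq, eventually_atTop] at h
    obtain ⟨⟨T₁, R₁⟩, h⟩ := h
    exact ⟨T₁, R₁, fun T hT R hR => h (T, R) ⟨hT, hR⟩⟩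
  -- The decay of `R^r exp(-g)` is known only for large `T` and `R` jointly. For `T < T₁ ≤ T₂` the
  -- sets `U_T` lie in one ball of radius `M`, so shells beyond it are empty.
  set T₂ := max T₁ (T₀ + 1) with hT₂
  have hT₂0 : T₀ < T₂ := lt_of_lt_of_le (by linarith) (le_max_right _ _)
  obtain ⟨M, hM⟩ := exists_norm_le_of_mem_localSet (a := a) (θ := θ) hΘ_bdd (hd_int T₂ hT₂0)
  -- The entry `exp(G₀/r)` forces `g ≥ G₀`: the decay gives `exp(g) ≥ R^r ≥ exp(G₀)`.
  set R₂ := max (max R₁ M) (max 1 (Real.exp (G₀ / r))) with hR₂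
  have hR₂1 : 1 ≤ R₂ := (le_max_left _ _).trans (le_max_right _ _)
  have hgG₀ : ∀ T, T₁ ≤ T → ∀ R, R₂ ≤ R → G₀ ≤ g T R := by
    intro T hT R hR
    have h1 := hdec T hT R (((le_max_left _ _).trans (le_max_left _ _)).trans hR)
    have h2 : Real.exp (G₀ / r) ≤ R := ((le_max_right _ _).trans (le_max_right _ _)).trans hR
    have h3 : Real.exp G₀ ≤ R ^ r := by
      have := Real.rpow_le_rpow (Real.exp_pos _).le h2 hr0.le
      rwa [← Real.exp_mul, div_mul_cancel₀ _ hr0.ne'] at this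
    have h4 : Real.exp (G₀ - g T R) ≤ 1 := by
      rw [sub_eq_add_neg, Real.exp_add]
      exact (mul_le_mul_of_nonneg_right h3 (Real.exp_pos _).le).trans h1
    have := Real.exp_le_one_iff.1 h4
    linarith
  obtain ⟨D, hD⟩ := (isCompact_Icc (a := (0 : ℝ)) (b := R₂)).exists_bound_of_continuousOn
    (f := fun x => γ₂.eval x) γ₂.continuous.continuousOn
  -- The first term makes the bound trivial for `R ≤ R₂`, where a nonempty shell gives `g ≤ c D`;
  -- the second is the sum over shells.
  set B₀ := Real.exp (b₀ * (c * D)) + C' * ∑' k : ℕ, 1 / ((k : ℝ) + 1) ^ 2 with hB₀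
  have hS0 : 0 ≤ C' * ∑' k : ℕ, 1 / ((k : ℝ) + 1) ^ 2 :=
    mul_nonneg hC'0 (tsum_nonneg fun k => by positivity)
  have hB₀pos : 0 < B₀ := by positivity
  refine ⟨B₀, b₀, hB₀pos, hb0, hb, fun T hT R hR est hest => ?_⟩
  have hT0 : 0 < T := hT₀.trans_lt hT
  have hR0 : 0 < R := hR₀.trans_lt hR
  rcases (shell a Θ θ T R).eq_empty_or_nonempty with hemp | hne
  -- By star-shapedness an empty shell means that no point of `U_T` lies at distance `R` or more.
  · have : {ω | R ≤ ‖diagMul (normCoeff a θ T) (est ω - θ)‖} = ∅ := by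
      refine eq_empty_of_forall_notMem fun ω hω => ?_
      have := shell_nonempty_of_mem_localSet hΘ_conv hθ hR0
        ⟨est ω, hest.mem_closure ω, rfl⟩ hω
      rw [hemp] at this
      exact not_nonempty_empty this
    rw [this, measureReal_empty]
    positivity
  by_cases hlarge : T₁ ≤ T ∧ R₂ ≤ R
  · obtain ⟨hTl, hRl⟩ := hlarge
    have hR1 : 1 ≤ R := hR₂1.trans hRl
    obtain ⟨N, hN, hsub⟩ := exists_null_deviation_subset_iUnion hN1 hT0.le hθ (hd_pos T hT)
      (hinc T hT) hest R
    have hB : ∀ k : ℕ, P.real {ω | ∃ u ∈ shell a Θ θ T (R + k),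
        1 / 2 * distFun a θ T u 0 ≤ noiseFunctional ε a θ T u ω} ≤
          C' * Real.exp (-b₀ * g T R) * (1 / ((k : ℝ) + 1) ^ 2) := fun k => by
      have hk : (0 : ℝ) ≤ k := Nat.cast_nonneg k
      exact (hshell T hT (R + k) (by linarith) (by linarith)
        (hgG₀ T hTl _ (by linarith))).trans
        (mul_pow_mul_exp_neg_le (hg.monotone T hT0) hC'0 hR1 hb0 hb1
          (fun x hx => hdec T hTl x
            ((((le_max_left _ _).trans (le_max_left _ _)).trans hRl).trans hx)) k)
    refine (measureReal_le_tsum_of_subset_iUnion hN hsub hB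
      (summable_one_div_add_one_sq.mul_left _)).trans ?_
    rw [tsum_mul_left, hB₀, add_mul]
    have := Real.exp_pos (b₀ * (c * D))
    have := Real.exp_pos (-b₀ * g T R)
    nlinarith
  · have hRR₂ : R ≤ R₂ := by
      by_contra! hlt
      have hTT₁ : T < T₁ := not_le.1 fun h => hlarge ⟨h, hlt.le⟩
      obtain ⟨u, hu⟩ := hne
      have h1 := hM T hT0.le (hTT₁.le.trans (le_max_left _ _)) u hu.1
      have h2 : M ≤ R₂ := (le_max_right _ _).trans (le_max_left _ _)
      have h3 := hu.2.1
      linarith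
    have h1 : g T R ≤ c * D := (hg_le T hT R hR hne).trans
      (mul_le_mul_of_nonneg_left ((le_abs_self _).trans (hD R ⟨hR0.le, hRR₂⟩)) hc0.le)
    calc P.real {ω | R ≤ ‖diagMul (normCoeff a θ T) (est ω - θ)‖} ≤ 1 := measureReal_le_one
      _ = Real.exp (b₀ * (c * D)) * Real.exp (-b₀ * (c * D)) := by
          rw [← Real.exp_add]; ring_nf; simp
      _ ≤ B₀ * Real.exp (-b₀ * g T R) := by
          refine mul_le_mul (by linarith) (Real.exp_le_exp.2 ?_) (Real.exp_pos _).le hB₀pos.le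
          simp only [neg_mul, neg_le_neg_iff]
          exact mul_le_mul_of_nonneg_left h1 hb0.le
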